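/- Let $T:\Omega\to\Omega$ be a bijective, bimeasurable transformation of a probability space $(\Omega,\mathcal A,\mathbf P)$ preserving $\mathbf P$, let $\mathcal F_0\subseteq\mathcal A$ be a $\sigma$-algebra with $\mathcal F_0\subseteq T^{-1}(\mathcal F_0)$, and put $\mathcal F_i=T^{-i}(\mathcal F_0)$ for $i\in\mathbf Z$, $\mathcal F_{-\infty}=\bigcap_{n\ge0}\mathcal F_{-n}$, $\mathcal F_\infty=\bigvee_{k\in\mathbf Z}\mathcal F_k$ and $P_j(Y)=\mathbf E(Y|\mathcal F_j)-\mathbf E(Y|\mathcal F_{j-1})$. For $\alpha>0$ let $\mathcal A_\alpha$ be the class of nondecreasing continuous functions $\Psi:[0,\infty)\to[0,\infty)$ with $\Psi(0)=0$ and $\Psi(cx)\le c^\alpha\Psi(x)$ for all $c\ge2$, $x\ge0$. For convex $\Psi\in\mathcal A_\alpha$, not identically zero, let $L_\Psi$ be the Orlicz space of random variables $X$ such that $\mathbf E\,\Psi(|X|/c)<\infty$ for some $c>0$, with the norm $\|X\|_\Psi=\inf\{c>0:\mathbf E\,\Psi(|X|/c)\le1\}$. For every $\alpha>0$ there is a constant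 $C_\alpha>0$, depending only on $\alpha$, such that the following holds for all such $(\Omega,\mathcal A,\mathbf P)$, $T$ and $\mathcal F_0$. Let $\Psi\in\mathcal A_\alpha$ be convex, not identically zero, and such that $x\mapsto\Psi(\sqrt x)$ is convex on $[0,\infty)$. Let $\xi_0\in L_\Psi$ be $\mathcal F_\infty$-measurable with $\mathbf E(\xi_0|\mathcal F_{-\infty})=0$ almost surely, and put $\xi_i=\xi_0\circ T^i$, $i\in\mathbf Z$. For every positive integer $n$ let $(c_{n,i})_{i\in\mathbf Z}$ be a real sequence with $\sum_{i}c_{n,i}^2<\infty$. Assume that $\sum_{j\in\mathbf Z}\|P_0(\xi_j)\|_\Psi<\infty$. Then, for every $j\in\mathbf Z$, the series $d_j=\sum_{\ell\in\mathbf Z}P_j(\xi_\ell)$ converges in $L_\Psi$; for every positive integer $n$ the series $\sum_{i\in\mathbf Z}c_{n,i}(\xi_i-d_i)$ converges unconditionally in $L_\Psi$; and for all positive integers $n$ and $m$, $$\Big\|\sum_{i\in\mathbf Z}c_{n,i}(\xi_i-d_i)\Big\|_\Psi\le 2C_\alpha\Big(\sum_{i\in\mathbf Z}c_{n,i}^2\Big)^{1/2}\sum_{|k|\ge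 m}\|P_0(\xi_k)\|_\Psi+3C_\alpha m\Big(\sum_{j\in\mathbf Z}(c_{n,j}-c_{n,j-1})^2\Big)^{1/2}\sum_{j\in\mathbf Z}\|P_0(\xi_j)\|_\Psi .$$ -/

import Mathlib

open MeasureTheory Set Filter Topology
open scoped ENNReal

/-- The class `𝒜_α`: functions `Ψ : ℝ₊ → ℝ₊` with `Ψ 0 = 0`, nondecreasing, continuous, with
`Ψ (c x) ≤ c ^ α Ψ x` for all `c ≥ 2`, `x ≥ 0`. A function on `ℝ₊` is represented by a function on
`ℝ` of which only the values on `[0, ∞)` are ever used. -/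
structure ClassA (α : ℝ) (Ψ : ℝ → ℝ) : Prop where
  nonneg : ∀ x, 0 ≤ x → 0 ≤ Ψ x
  map_zero : Ψ 0 = 0
  mono : MonotoneOn Ψ (Ici 0)
  cont : ContinuousOn Ψ (Ici 0)
  growth : ∀ c x : ℝ, 2 ≤ c → 0 ≤ x → Ψ (c * x) ≤ c ^ α * Ψ x

section Orlicz

variable {Ω : Type*} {mΩ : MeasurableSpace Ω}

/-- The modular `𝔼 Ψ(|X| / c)`, as an extended nonnegative number. -/
noncomputable def orliczModular (Ψ : ℝ → ℝ) (μ : Measure Ω) (X : Ω → ℝ) (c : ℝ) : ℝ≥0∞ :=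
  ∫⁻ ω, ENNReal.ofReal (Ψ (|X ω| / c)) ∂μ

/-- The Orlicz space `L_Ψ`: random variables `X` with `𝔼 Ψ(|X| / c) < ∞` for some `c > 0`. -/
def MemOrlicz (Ψ : ℝ → ℝ) (μ : Measure Ω) (X : Ω → ℝ) : Prop :=
  AEMeasurable X μ ∧ ∃ c : ℝ, 0 < c ∧ orliczModular Ψ μ X c < ∞

/-- The Luxemburg norm `‖X‖_Ψ = inf {c > 0 | 𝔼 Ψ(|X| / c) ≤ 1}`; it is `∞` when there is no such
`c`. -/
noncomputable def orliczNorm (Ψ : ℝ → ℝ) (μ : Measure Ω) (X : Ω → ℝ) : ℝ≥0∞ :=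
  ⨅ (c : ℝ) (_ : 0 < c ∧ orliczModular Ψ μ X c ≤ 1), ENNReal.ofReal c

/-- The series `∑ i, f i` converges (unconditionally) in the space `L_Ψ`, with sum `S`. -/
def OrliczHasSum {ι : Type*} (Ψ : ℝ → ℝ) (μ : Measure Ω) (f : ι → Ω → ℝ) (S : Ω → ℝ) : Prop :=
  MemOrlicz Ψ μ S ∧
    Tendsto (fun s : Finset ι => orliczNorm Ψ μ (fun ω => (∑ i ∈ s, f i ω) - S ω)) atTop (𝓝 0)

end Orlicz

section Stationary

variable {Ω : Type*} {mΩ : MeasurableSpace Ω}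

/-- The iterate `T ^ i`, for `i ∈ ℤ`, of a bijective transformation. -/
def shiftPow (T : Ω ≃ᵐ Ω) (i : ℤ) : Ω → Ω :=
  ((T.toEquiv : Equiv.Perm Ω) ^ i : Equiv.Perm Ω)

/-- The strictly stationary sequence `ξ_i = ξ₀ ∘ T ^ i`. -/
def stationarySeq (T : Ω ≃ᵐ Ω) (ξ₀ : Ω → ℝ) (i : ℤ) : Ω → ℝ :=
  ξ₀ ∘ shiftPow T i

/-- The stationary filtration `ℱ_i = T ^ (-i) ℱ₀`, the sets `(T ^ i) ⁻¹' A` with `A ∈ ℱ₀`. -/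
abbrev statFiltration (T : Ω ≃ᵐ Ω) (F₀ : MeasurableSpace Ω) (i : ℤ) : MeasurableSpace Ω :=
  F₀.comap (shiftPow T i)

/-- `ξ₀` is regular: `𝔼(ξ₀ | ℱ_{-∞}) = 0` almost surely, with `ℱ_{-∞} = ⋂_{n ≥ 0} ℱ_{-n}`, and
`ξ₀` is measurable for `ℱ_∞ = ⋁_k ℱ_k`. -/
def IsRegularVar (μ : Measure Ω) (T : Ω ≃ᵐ Ω) (F₀ : MeasurableSpace Ω) (ξ₀ : Ω → ℝ) : Prop :=
  condExp (⨅ n : ℕ, statFiltration T F₀ (-(n : ℤ))) μ ξ₀ =ᵐ[μ] 0 ∧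
    Measurable[⨆ k : ℤ, statFiltration T F₀ k] ξ₀

/-- The projection `P_j(Y) = 𝔼(Y | ℱ_j) - 𝔼(Y | ℱ_{j-1})`. -/
noncomputable def proj (μ : Measure Ω) (T : Ω ≃ᵐ Ω) (F₀ : MeasurableSpace Ω) (j : ℤ)
    (Y : Ω → ℝ) : Ω → ℝ :=
  condExp (statFiltration T F₀ j) μ Y - condExp (statFiltration T F₀ (j - 1)) μ Y

/-- `d_j = ∑_{ℓ ∈ ℤ} P_j(ξ_ℓ)`, summed pointwise. -/
noncomputable def martDiff (μ : Measure Ω) (T : Ω ≃ᵐ Ω) (F₀ : MeasurableSpace Ω)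
    (ξ₀ : Ω → ℝ) (j : ℤ) : Ω → ℝ :=
  fun ω => ∑' l : ℤ, proj μ T F₀ j (stationarySeq T ξ₀ l) ω

end Stationary

/-!
The theorem rests on a martingale inequality in `L_Ψ`: if `Y_j` are martingale differences with
`‖Y_j‖_Ψ ≤ θ`, then `‖∑ a_j Y_j‖_Ψ ≤ C_α (∑ a_j ^ 2) ^ (1/2) θ`
(`orliczNorm_sum_martingale_le`). It is proved directly, without maximal functions or a
Burkholder inequality. The potential `F(x) = ∫₀ˣ 2 Ψ(|u|) / u du` is comparable to `Ψ(|x|)`, and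
because `Ψ(√x)` is convex and `Ψ` is doubling it satisfies, for `|a| ≤ 1`,
`F(x + a z) ≤ F(x) + a F'(x) z + 4 ^ α a ^ 2 (Ψ(|x|) + Ψ(|z|))` (`ClassA.potential_add_le`).
Along a martingale the linear term has mean zero, so each step multiplies `𝔼 F(S) + 1` by at most
`1 + 8 ^ α a_j ^ 2` when `𝔼 Ψ(|Y_j|) ≤ 1`, and the product of these factors stays below
`exp (8 ^ α ∑ a_j ^ 2)`.

For the approximation, put `y_{k,j} = P_j(ξ_{j+k})`. By stationarity `‖y_{k,j}‖_Ψ = ‖P_0(ξ_k)‖_Ψ`,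
and for fixed `k` these are martingale differences in `j`. Regularity gives `ξ_i = ∑_k y_{k,i-k}`
(`hasSum_condExp_sub`), while `d_i = ∑_k y_{k,i}` by definition. Hence, for finitely supported
weights, `∑_i c_i (ξ_i - d_i) = ∑_k ∑_j (c_{j+k} - c_j) y_{k,j}`. The martingale inequality on each
diagonal `k`, with the `ℓ²`-norm of `c_{·+k} - c` bounded by `2 ‖c‖` for `|k| ≥ m` and by
`|k| ‖c - c_{·-1}‖` for `|k| < m`, gives the estimate (`orliczNorm_sum_mul_sub_le`). General weights
follow by truncation, since the same bound gives the Cauchy criterion and `L_Ψ` is complete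
(`exists_orliczHasSum`).
-/

/-! ### Elementary properties of the class `𝒜_α` -/

namespace ClassA

variable {α : ℝ} {Ψ : ℝ → ℝ}

theorem continuous_comp_abs (hΨ : ClassA α Ψ) : Continuous fun x => Ψ |x| :=
  hΨ.cont.comp_continuous continuous_abs fun x => abs_nonneg x

theorem map_abs_nonneg (hΨ : ClassA α Ψ) (x : ℝ) : 0 ≤ Ψ |x| := hΨ.nonneg _ (abs_nonneg x)

theorem mono_of_nonneg (hΨ : ClassA α Ψ) {x y : ℝ} (hx : 0 ≤ x) (hxy : x ≤ y) : Ψ x ≤ Ψ y :=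
  hΨ.mono hx (hx.trans hxy) hxy

theorem continuous_comp_abs_div (hΨ : ClassA α Ψ) {c : ℝ} (hc : 0 < c) :
    Continuous fun x => Ψ (|x| / c) := by
  have : (fun x : ℝ => Ψ (|x| / c)) = fun x => Ψ |x / c| := by
    funext x; rw [abs_div, abs_of_pos hc]
  rw [this]
  exact hΨ.continuous_comp_abs.comp (continuous_id.div_const c)

/-- Since `Ψ` is convex with `Ψ 0 = 0`, it is subhomogeneous for factors in `[0, 1]`. -/
theorem map_mul_le (hΨ : ClassA α Ψ) (hconv : ConvexOn ℝ (Ici 0) Ψ) {t x : ℝ} (ht0 : 0 ≤ t)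
    (ht1 : t ≤ 1) (hx : 0 ≤ x) : Ψ (t * x) ≤ t * Ψ x := by
  have h := hconv.2 (show (0 : ℝ) ∈ Ici 0 by simp) (show x ∈ Ici (0 : ℝ) from hx)
    (sub_nonneg.2 ht1) ht0 (by ring)
  simpa [hΨ.map_zero] using h

/-- Jensen's inequality for weights of total mass at most one. -/
theorem map_sum_le (hΨ : ClassA α Ψ) (hconv : ConvexOn ℝ (Ici 0) Ψ) {ι : Type*} (s : Finset ι)
    {w u : ι → ℝ} (hw : ∀ i ∈ s, 0 ≤ w i) (hs : ∑ i ∈ s, w i ≤ 1) (hu : ∀ i ∈ s, 0 ≤ u i) :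
    Ψ (∑ i ∈ s, w i * u i) ≤ ∑ i ∈ s, w i * Ψ (u i) := by
  have h := hconv.map_add_sum_le (t := s) (w := w) (p := u) (v := 1 - ∑ i ∈ s, w i) (q := 0)
    hw (by ring) hu (sub_nonneg.2 hs) (by simp)
  simpa [hΨ.map_zero] using h

end ClassA

/-! ### The Luxemburg norm -/

section Luxemburg

variable {Ω : Type*} {mΩ : MeasurableSpace Ω} {μ : Measure Ω} {α : ℝ} {Ψ : ℝ → ℝ}

theorem ClassA.aemeasurable_modular (hΨ : ClassA α Ψ) {X : Ω → ℝ} (hX : AEMeasurable X μ) {c : ℝ}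
    (hc : 0 < c) : AEMeasurable (fun ω => ENNReal.ofReal (Ψ (|X ω| / c))) μ :=
  ((hΨ.continuous_comp_abs_div hc).measurable.comp_aemeasurable hX).ennreal_ofReal

theorem orliczModular_mono (hΨ : ClassA α Ψ) {X Y : Ω → ℝ} {c c' : ℝ} (hc : 0 < c) (hcc : c ≤ c')
    (h : ∀ᵐ ω ∂μ, |X ω| ≤ |Y ω|) : orliczModular Ψ μ X c' ≤ orliczModular Ψ μ Y c := by
  refine lintegral_mono_ae ?_
  filter_upwards [h] with ω hω
  refine ENNReal.ofReal_le_ofReal (hΨ.mono_of_nonneg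
    (div_nonneg (abs_nonneg _) (hc.trans_le hcc).le) ?_)
  gcongr

theorem orliczNorm_le_of_modular {X : Ω → ℝ} {c : ℝ} (hc : 0 < c)
    (h : orliczModular Ψ μ X c ≤ 1) : orliczNorm Ψ μ X ≤ ENNReal.ofReal c :=
  iInf₂_le c ⟨hc, h⟩

theorem orliczModular_le_one_of_norm_lt (hΨ : ClassA α Ψ) {X : Ω → ℝ} {c : ℝ}
    (h : orliczNorm Ψ μ X < ENNReal.ofReal c) : orliczModular Ψ μ X c ≤ 1 := by
  simp only [orliczNorm, iInf_lt_iff] at h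
  obtain ⟨b, ⟨hb, hb1⟩, hbc⟩ := h
  exact (orliczModular_mono hΨ hb (ENNReal.ofReal_lt_ofReal_iff_of_nonneg hb.le |>.1 hbc).le
    (ae_of_all _ fun _ => le_rfl)).trans hb1

theorem orliczNorm_mono (hΨ : ClassA α Ψ) {X Y : Ω → ℝ} (h : ∀ᵐ ω ∂μ, |X ω| ≤ |Y ω|) :
    orliczNorm Ψ μ X ≤ orliczNorm Ψ μ Y :=
  le_iInf₂ fun _ hc => orliczNorm_le_of_modular hc.1
    ((orliczModular_mono hΨ hc.1 le_rfl h).trans hc.2)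

theorem orliczNorm_congr (hΨ : ClassA α Ψ) {X Y : Ω → ℝ} (h : X =ᵐ[μ] Y) :
    orliczNorm Ψ μ X = orliczNorm Ψ μ Y :=
  le_antisymm (orliczNorm_mono hΨ (h.mono fun _ h => by rw [h]))
    (orliczNorm_mono hΨ (h.mono fun _ h => by rw [h]))

theorem orliczNorm_sub_comm (hΨ : ClassA α Ψ) (X Y : Ω → ℝ) :
    orliczNorm Ψ μ (fun ω => X ω - Y ω) = orliczNorm Ψ μ (fun ω => Y ω - X ω) :=
  le_antisymm (orliczNorm_mono hΨ (ae_of_all _ fun _ => (abs_sub_comm _ _).le))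
    (orliczNorm_mono hΨ (ae_of_all _ fun _ => (abs_sub_comm _ _).le))

theorem orliczNorm_zero (hΨ : ClassA α Ψ) : orliczNorm Ψ μ (fun _ => 0) = 0 := by
  refine le_antisymm (ENNReal.le_of_forall_pos_le_add fun ε hε _ => ?_) bot_le
  rw [zero_add, ← ENNReal.ofReal_coe_nnreal]
  exact orliczNorm_le_of_modular hε (by simp [orliczModular, hΨ.map_zero])

/-- The Luxemburg norm depends only on the distribution. -/
theorem orliczNorm_comp_measurePreserving (hΨ : ClassA α Ψ) {X : Ω → ℝ} (hX : AEMeasurable X μ)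
    {g : Ω → Ω} (hg : MeasurePreserving g μ μ) :
    orliczNorm Ψ μ (X ∘ g) = orliczNorm Ψ μ X := by
  have h : ∀ c, 0 < c → orliczModular Ψ μ (X ∘ g) c = orliczModular Ψ μ X c := by
    intro c hc
    have hm := hΨ.aemeasurable_modular hX hc
    rw [← hg.map_eq] at hm
    have := lintegral_map' hm hg.aemeasurable
    rw [hg.map_eq] at this
    exact this.symm
  refine iInf_congr fun c => iInf_congr_Prop ?_ fun _ => rfl
  constructor <;> rintro ⟨hc, h1⟩ <;> refine ⟨hc, ?_⟩ <;> simpa [h c hc] using h1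

/-- The countable triangle inequality, for a series that converges almost everywhere. -/
theorem orliczNorm_le_tsum (hΨ : ClassA α Ψ) (hconv : ConvexOn ℝ (Ici 0) Ψ) {ι : Type*}
    [Countable ι] {X : ι → Ω → ℝ} {S : Ω → ℝ} (hX : ∀ i, AEMeasurable (X i) μ)
    (hS : ∀ᵐ ω ∂μ, HasSum (fun i => X i ω) (S ω)) :
    orliczNorm Ψ μ S ≤ ∑' i, orliczNorm Ψ μ (X i) := by
  rcases isEmpty_or_nonempty ι with hι | hι
  · rw [orliczNorm_congr hΨ (Y := fun _ => 0), orliczNorm_zero hΨ]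
    · exact bot_le
    · filter_upwards [hS] with ω hω
      exact hω.unique (by simp)
  refine ENNReal.le_of_forall_pos_le_add fun ε hε hfin => ?_
  obtain ⟨δ, hδ, hδε⟩ := ENNReal.exists_pos_sum_of_countable (ENNReal.coe_pos.2 hε).ne' ι
  have hne : ∀ i, orliczNorm Ψ μ (X i) ≠ ∞ := fun i => (ENNReal.ne_top_of_tsum_ne_top hfin.ne i)
  -- real numbers slightly above the norms, positive so that every `X i` can be divided by `b i`;
  -- Jensen's inequality is applied with the weights `b i / ∑ b`
  set b : ι → ℝ := fun i => (orliczNorm Ψ μ (X i)).toReal + δ i with hb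
  have hbpos : ∀ i, 0 < b i := fun i => add_pos_of_nonneg_of_pos ENNReal.toReal_nonneg (hδ i)
  have hbof : ∀ i, ENNReal.ofReal (b i) = orliczNorm Ψ μ (X i) + δ i := fun i => by
    simp only [hb]
    rw [ENNReal.ofReal_add ENNReal.toReal_nonneg (δ i).coe_nonneg, ENNReal.ofReal_toReal (hne i),
      ENNReal.ofReal_coe_nnreal]
  have hmod : ∀ i, orliczModular Ψ μ (X i) (b i) ≤ 1 := fun i => by
    refine orliczModular_le_one_of_norm_lt hΨ ?_
    rw [hbof]
    exact ENNReal.lt_add_right (hne i) (by simpa using (hδ i).ne')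
  have hsum : ∑' i, ENNReal.ofReal (b i) ≤ ∑' i, orliczNorm Ψ μ (X i) + ε := by
    simp_rw [hbof]
    rw [ENNReal.tsum_add]
    gcongr
  have hsumtop : ∑' i, ENNReal.ofReal (b i) ≠ ∞ :=
    (hsum.trans_lt (ENNReal.add_lt_top.2 ⟨hfin, ENNReal.coe_lt_top⟩)).ne
  have hbs : Summable b := by
    have := ENNReal.summable_toReal hsumtop
    simpa only [ENNReal.toReal_ofReal (hbpos _).le] using this
  set B : ℝ := ∑' i, b i with hB
  have hBof : ENNReal.ofReal B = ∑' i, ENNReal.ofReal (b i) :=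
    ENNReal.ofReal_tsum_of_nonneg (fun i => (hbpos i).le) hbs
  have hBpos : 0 < B := hbs.tsum_pos (fun i => (hbpos i).le) hι.some (hbpos _)
  refine le_trans ?_ hsum
  rw [← hBof]
  refine orliczNorm_le_of_modular hBpos ?_
  have hpt : ∀ᵐ ω ∂μ, ENNReal.ofReal (Ψ (|S ω| / B)) ≤
      ∑' i, ENNReal.ofReal (b i / B) * ENNReal.ofReal (Ψ (|X i ω| / b i)) := by
    filter_upwards [hS] with ω hω
    have hlim : Tendsto (fun s : Finset ι => ENNReal.ofReal (Ψ (|∑ i ∈ s, X i ω| / B))) atTop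
        (𝓝 (ENNReal.ofReal (Ψ (|S ω| / B)))) :=
      (ENNReal.continuous_ofReal.tendsto _).comp
        (((hΨ.continuous_comp_abs_div hBpos).tendsto _).comp hω)
    refine le_of_tendsto' hlim fun s => ?_
    refine le_trans ?_ (ENNReal.sum_le_tsum s)
    have hj := hΨ.map_sum_le hconv s (w := fun i => b i / B) (u := fun i => |X i ω| / b i)
      (fun i _ => (div_pos (hbpos i) hBpos).le)
      (by
        rw [← Finset.sum_div, div_le_one hBpos]
        exact hbs.sum_le_tsum s fun i _ => (hbpos i).le)
      (fun i _ => div_nonneg (abs_nonneg _) (hbpos i).le)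
    have hle : Ψ (|∑ i ∈ s, X i ω| / B) ≤ Ψ (∑ i ∈ s, b i / B * (|X i ω| / b i)) := by
      refine hΨ.mono_of_nonneg (by positivity) ?_
      have : ∀ i ∈ s, b i / B * (|X i ω| / b i) = |X i ω| / B := fun i _ => by
        have := (hbpos i).ne'
        field_simp
      rw [Finset.sum_congr rfl this, ← Finset.sum_div]
      gcongr
      exact Finset.abs_sum_le_sum_abs _ _
    refine (ENNReal.ofReal_le_ofReal (hle.trans hj)).trans ?_
    rw [ENNReal.ofReal_sum_of_nonneg fun i _ => mul_nonneg (div_pos (hbpos i) hBpos).le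
      (hΨ.nonneg _ (div_nonneg (abs_nonneg _) (hbpos i).le))]
    exact Finset.sum_le_sum fun i _ => (ENNReal.ofReal_mul (div_pos (hbpos i) hBpos).le).le
  refine (lintegral_mono_ae hpt).trans ?_
  rw [lintegral_tsum fun i => (hΨ.aemeasurable_modular (hX i) (hbpos i)).const_mul _]
  calc ∑' i, ∫⁻ ω, ENNReal.ofReal (b i / B) * ENNReal.ofReal (Ψ (|X i ω| / b i)) ∂μ
      ≤ ∑' i, ENNReal.ofReal (b i / B) := by
        refine ENNReal.tsum_le_tsum fun i => ?_
        rw [lintegral_const_mul'' _ (hΨ.aemeasurable_modular (hX i) (hbpos i))]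
        exact mul_le_of_le_one_right bot_le (hmod i)
    _ = 1 := by
        rw [← ENNReal.ofReal_tsum_of_nonneg (fun i => (div_pos (hbpos i) hBpos).le)
          (hbs.div_const B), tsum_div_const, ← hB, div_self hBpos.ne', ENNReal.ofReal_one]

theorem orliczNorm_add_le (hΨ : ClassA α Ψ) (hconv : ConvexOn ℝ (Ici 0) Ψ) {X Y : Ω → ℝ}
    (hX : AEMeasurable X μ) (hY : AEMeasurable Y μ) :
    orliczNorm Ψ μ (fun ω => X ω + Y ω) ≤ orliczNorm Ψ μ X + orliczNorm Ψ μ Y := by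
  have := orliczNorm_le_tsum hΨ hconv (X := fun b : Bool => if b then X else Y)
    (S := fun ω => X ω + Y ω) (μ := μ) (by simp [hX, hY])
    (ae_of_all _ fun ω => by
      simpa using hasSum_fintype fun b : Bool => (if b then X else Y) ω)
  simpa [tsum_fintype] using this

/-- The Luxemburg norm is lower semicontinuous for convergence almost everywhere. -/
theorem orliczNorm_le_of_tendsto (hΨ : ClassA α Ψ) {X : ℕ → Ω → ℝ} {S : Ω → ℝ}
    (hX : ∀ n, AEMeasurable (X n) μ) (hS : ∀ᵐ ω ∂μ, Tendsto (fun n => X n ω) atTop (𝓝 (S ω)))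
    {C : ℝ≥0∞} (hC : ∀ᶠ n in atTop, orliczNorm Ψ μ (X n) ≤ C) : orliczNorm Ψ μ S ≤ C := by
  refine ENNReal.le_of_forall_pos_le_add fun ε hε hfin => ?_
  lift C to NNReal using hfin.ne
  set c : ℝ := C + ε with hc
  have hcpos : 0 < c := add_pos_of_nonneg_of_pos C.2 hε
  have hcof : ENNReal.ofReal c = (C : ℝ≥0∞) + ε := by
    rw [hc, ← NNReal.coe_add, ENNReal.ofReal_coe_nnreal, ENNReal.coe_add]
  rw [← hcof]
  refine orliczNorm_le_of_modular hcpos ?_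
  calc orliczModular Ψ μ S c
      = ∫⁻ ω, liminf (fun n => ENNReal.ofReal (Ψ (|X n ω| / c))) atTop ∂μ := by
        refine lintegral_congr_ae ?_
        filter_upwards [hS] with ω hω
        exact (((ENNReal.continuous_ofReal.tendsto _).comp
          (((hΨ.continuous_comp_abs_div hcpos).tendsto _).comp hω)).liminf_eq).symm
    _ ≤ liminf (fun n => orliczModular Ψ μ (X n) c) atTop :=
        lintegral_liminf_le' fun n => hΨ.aemeasurable_modular (hX n) hcpos
    _ ≤ 1 := by
        refine liminf_le_of_frequently_le' (Eventually.frequently ?_)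
        filter_upwards [hC] with n hn
        refine orliczModular_le_one_of_norm_lt hΨ (hn.trans_lt ?_)
        rw [hcof]
        exact ENNReal.lt_add_right (by simp) (by simpa using hε.ne')

/-- Membership in `L_Ψ` means that the norm is finite: by convexity, a finite modular becomes at
most one after rescaling. -/
theorem memOrlicz_iff (hΨ : ClassA α Ψ) (hconv : ConvexOn ℝ (Ici 0) Ψ) {X : Ω → ℝ} :
    MemOrlicz Ψ μ X ↔ AEMeasurable X μ ∧ orliczNorm Ψ μ X < ∞ := by
  refine and_congr_right fun hX => ⟨?_, fun h => ?_⟩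
  · rintro ⟨c, hc, hfin⟩
    -- dividing `X` by a factor `t ≥ 1` divides the modular by at least `t`
    set t : ℝ := max 1 (orliczModular Ψ μ X c).toReal with ht
    have ht1 : 1 ≤ t := le_max_left _ _
    have ht0 : 0 < t := one_pos.trans_le ht1
    refine (orliczNorm_le_of_modular (mul_pos ht0 hc) ?_).trans_lt ENNReal.ofReal_lt_top
    have hle : orliczModular Ψ μ X (t * c) ≤ ENNReal.ofReal t⁻¹ * orliczModular Ψ μ X c := by
      rw [orliczModular, orliczModular, ← lintegral_const_mul'' _ (hΨ.aemeasurable_modular hX hc)]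
      refine lintegral_mono fun ω => ?_
      rw [← ENNReal.ofReal_mul (by positivity)]
      refine ENNReal.ofReal_le_ofReal ?_
      have := hΨ.map_mul_le hconv (t := t⁻¹) (x := |X ω| / c) (by positivity)
        (inv_le_one_of_one_le₀ ht1) (by positivity)
      rwa [show |X ω| / (t * c) = t⁻¹ * (|X ω| / c) by field_simp]
    refine hle.trans ?_
    rw [← ENNReal.ofReal_toReal hfin.ne, ← ENNReal.ofReal_mul (by positivity)]
    refine ENNReal.ofReal_le_one.2 ?_
    rw [inv_mul_le_iff₀ ht0, mul_one]
    exact le_max_right _ _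
  · obtain ⟨c, hc⟩ := ENNReal.lt_iff_exists_nnreal_btwn.1 h
    have hc0 : 0 < (c : ℝ) := by
      have := bot_le.trans_lt hc.1
      simpa using this
    refine ⟨c, hc0, (orliczModular_le_one_of_norm_lt hΨ ?_).trans_lt ENNReal.one_lt_top⟩
    simpa using hc.1

/-- On a probability space `L_Ψ` embeds continuously into `L¹`, as `Ψ` grows at least linearly. -/
theorem exists_lintegral_le_orliczNorm [IsProbabilityMeasure μ] (hΨ : ClassA α Ψ)
    (hconv : ConvexOn ℝ (Ici 0) Ψ) (hne : ∃ x : ℝ, 0 ≤ x ∧ Ψ x ≠ 0) :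
    ∃ K : ℝ, 0 ≤ K ∧ ∀ X : Ω → ℝ, AEMeasurable X μ →
      ∫⁻ ω, ‖X ω‖ₑ ∂μ ≤ ENNReal.ofReal K * orliczNorm Ψ μ X := by
  obtain ⟨x₀, hx₀, hΨx₀⟩ := hne
  have hΨpos : 0 < Ψ x₀ := lt_of_le_of_ne (hΨ.nonneg _ hx₀) (Ne.symm hΨx₀)
  have hx₀pos : 0 < x₀ := lt_of_le_of_ne hx₀ fun h => hΨx₀ (by rw [← h, hΨ.map_zero])
  have hlin : ∀ u, 0 ≤ u → u ≤ x₀ + x₀ / Ψ x₀ * Ψ u := by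
    intro u hu
    have h0 : 0 ≤ x₀ / Ψ x₀ * Ψ u := mul_nonneg (by positivity) (hΨ.nonneg _ hu)
    rcases le_total u x₀ with h | h
    · linarith
    · have hu0 : 0 < u := hx₀pos.trans_le h
      have := hΨ.map_mul_le hconv (t := x₀ / u) (x := u) (by positivity)
        ((div_le_one hu0).2 h) hu
      rw [div_mul_cancel₀ _ hu0.ne'] at this
      have h2 : u ≤ x₀ / Ψ x₀ * Ψ u := by
        rw [div_mul_eq_mul_div, le_div_iff₀ hΨpos]
        rw [div_mul_eq_mul_div, le_div_iff₀ hu0] at this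
        linarith
      linarith
  have hK0 : 0 ≤ x₀ + x₀ / Ψ x₀ := by positivity
  refine ⟨x₀ + x₀ / Ψ x₀, hK0, fun X hX => ?_⟩
  have key : ∀ c : ℝ, 0 < c → orliczModular Ψ μ X c ≤ 1 →
      ∫⁻ ω, ‖X ω‖ₑ ∂μ ≤ ENNReal.ofReal (x₀ + x₀ / Ψ x₀) * ENNReal.ofReal c := by
    intro c hc hmod
    calc ∫⁻ ω, ‖X ω‖ₑ ∂μ
        ≤ ∫⁻ ω, (ENNReal.ofReal (c * x₀) +
            ENNReal.ofReal (c * (x₀ / Ψ x₀)) * ENNReal.ofReal (Ψ (|X ω| / c))) ∂μ := by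
          refine lintegral_mono fun ω => ?_
          have hn : 0 ≤ Ψ (|X ω| / c) := hΨ.nonneg _ (by positivity)
          rw [← ENNReal.ofReal_mul (by positivity), ← ENNReal.ofReal_add (by positivity)
            (by positivity), Real.enorm_eq_ofReal_abs]
          refine ENNReal.ofReal_le_ofReal ?_
          have := mul_le_mul_of_nonneg_left (hlin (|X ω| / c) (by positivity)) hc.le
          rw [mul_div_cancel₀ _ hc.ne'] at this
          linarith
      _ = ENNReal.ofReal (c * x₀) + ENNReal.ofReal (c * (x₀ / Ψ x₀)) * orliczModular Ψ μ X c := by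
          rw [lintegral_add_left measurable_const,
            lintegral_const_mul'' _ (hΨ.aemeasurable_modular hX hc)]
          simp [orliczModular]
      _ ≤ ENNReal.ofReal (c * x₀) + ENNReal.ofReal (c * (x₀ / Ψ x₀)) * 1 := by gcongr
      _ = ENNReal.ofReal (x₀ + x₀ / Ψ x₀) * ENNReal.ofReal c := by
          rw [mul_one, ← ENNReal.ofReal_add (by positivity) (by positivity),
            ← ENNReal.ofReal_mul hK0]
          congr 1; ring
  rw [orliczNorm, ENNReal.mul_iInf_of_ne (by simp; positivity) (by simp)]
  refine le_iInf fun c => ?_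
  by_cases h : 0 < c ∧ orliczModular Ψ μ X c ≤ 1
  · simpa [h] using key c h.1 h.2
  · simp only [h, iInf_false]
    rw [ENNReal.mul_top (by simp; positivity)]
    exact le_top

end Luxemburg

/-! ### A smooth potential comparable to `Ψ` -/

/-- The odd function `x ↦ 2 Ψ(|x|) / x`, equal to `0` at the origin. -/
noncomputable def potentialDeriv (Ψ : ℝ → ℝ) (x : ℝ) : ℝ := 2 * Ψ |x| / x

/-- The even potential `∫₀ˣ 2 Ψ(|u|) / u du`. It is comparable to `Ψ(|x|)`, and, unlike `Ψ`, it
has a locally Lipschitz derivative. -/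
noncomputable def potential (Ψ : ℝ → ℝ) (x : ℝ) : ℝ := ∫ u in (0 : ℝ)..x, potentialDeriv Ψ u

section Potential

variable {α : ℝ} {Ψ : ℝ → ℝ}

theorem potentialDeriv_neg (x : ℝ) : potentialDeriv Ψ (-x) = -potentialDeriv Ψ x := by
  simp [potentialDeriv, div_neg]

theorem potential_neg (x : ℝ) : potential Ψ (-x) = potential Ψ x := by
  have h := intervalIntegral.integral_comp_neg (a := 0) (b := x) (potentialDeriv Ψ)
  simp only [potentialDeriv_neg, intervalIntegral.integral_neg, neg_zero] at h
  rw [potential, potential, intervalIntegral.integral_symm, ← h, neg_neg]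

theorem potential_abs (x : ℝ) : potential Ψ |x| = potential Ψ x := by
  rcases abs_choice x with h | h <;> rw [h]
  exact potential_neg x

theorem potential_zero : potential Ψ 0 = 0 := by simp [potential]

namespace ClassA

theorem map_two_mul_le (hΨ : ClassA α Ψ) {x : ℝ} (hx : 0 ≤ x) : Ψ (2 * x) ≤ 2 ^ α * Ψ x :=
  hΨ.growth 2 x le_rfl hx

/-- As `x ↦ Ψ(√x)` is convex and vanishes at `0`, the function `Ψ(x) / x ^ 2` is monotone. -/
theorem div_sq_mono (hΨ : ClassA α Ψ) (hsq : ConvexOn ℝ (Ici 0) fun x => Ψ √x)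
    {x y : ℝ} (hx : 0 < x) (hxy : x ≤ y) : Ψ x / x ^ 2 ≤ Ψ y / y ^ 2 := by
  have hy : 0 < y := hx.trans_le hxy
  have ht1 : (x / y) ^ 2 ≤ 1 := pow_le_one₀ (by positivity) ((div_le_one hy).2 hxy)
  have h := hsq.2 (show (0 : ℝ) ∈ Ici 0 by simp) (show y ^ 2 ∈ Ici (0 : ℝ) from sq_nonneg y)
    (sub_nonneg.2 ht1) (sq_nonneg (x / y)) (by ring)
  have e : (x / y) ^ 2 * y ^ 2 = x ^ 2 := by field_simp
  simp only [smul_eq_mul, mul_zero, zero_add, e, Real.sqrt_zero, hΨ.map_zero,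
    Real.sqrt_sq hx.le, Real.sqrt_sq hy.le] at h
  rw [div_le_div_iff₀ (by positivity) (by positivity)]
  calc Ψ x * y ^ 2 ≤ (x / y) ^ 2 * Ψ y * y ^ 2 := by gcongr
    _ = Ψ y * x ^ 2 := by field_simp

theorem div_mono (hΨ : ClassA α Ψ) (hconv : ConvexOn ℝ (Ici 0) Ψ) {x y : ℝ} (hx : 0 ≤ x)
    (hxy : x ≤ y) : Ψ x / x ≤ Ψ y / y := by
  rcases hx.eq_or_lt with rfl | hx
  · simpa using div_nonneg (hΨ.nonneg y hxy) hxy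
  have hy : 0 < y := hx.trans_le hxy
  have := hΨ.map_mul_le hconv (t := x / y) (x := y) (by positivity) ((div_le_one hy).2 hxy) hy.le
  rw [div_mul_cancel₀ _ hy.ne', div_mul_eq_mul_div, le_div_iff₀ hy] at this
  rw [div_le_div_iff₀ hx hy]
  linarith

theorem div_sub_div_le (hΨ : ClassA α Ψ) (hconv : ConvexOn ℝ (Ici 0) Ψ)
    (hsq : ConvexOn ℝ (Ici 0) fun x => Ψ √x) {x z R : ℝ} (hx : 0 ≤ x) (hxz : x ≤ z) (hzR : z ≤ R) :
    Ψ z / z - Ψ x / x ≤ 2 ^ α * (Ψ R / R ^ 2) * (z - x) := by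
  rcases hxz.eq_or_lt with rfl | hlt
  · simp
  have hz : 0 < z := hx.trans_lt hlt
  have h1 : Ψ x / z ≤ Ψ x / x := by
    rcases hx.eq_or_lt with rfl | hx
    · simp [hΨ.map_zero]
    · exact div_le_div_of_nonneg_left (hΨ.nonneg _ hx.le) hx hxz
  have h2 : (Ψ z - Ψ x) / (z - x) ≤ (Ψ (2 * z) - Ψ z) / (2 * z - z) :=
    hconv.slope_mono_adjacent hx (show (0 : ℝ) ≤ 2 * z by positivity) hlt (by linarith)
  have h3 : (Ψ z - Ψ x) / (z - x) ≤ 2 ^ α * Ψ z / z := by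
    refine h2.trans ?_
    rw [show 2 * z - z = z by ring]
    gcongr
    linarith [hΨ.map_two_mul_le hz.le, hΨ.nonneg z hz.le]
  have hd : 0 < z - x := sub_pos.2 hlt
  rw [div_le_iff₀ hd] at h3
  calc Ψ z / z - Ψ x / x ≤ (Ψ z - Ψ x) / z := by rw [sub_div]; linarith
    _ ≤ (2 ^ α * Ψ z / z * (z - x)) / z := by gcongr
    _ = 2 ^ α * (Ψ z / z ^ 2) * (z - x) := by field_simp
    _ ≤ 2 ^ α * (Ψ R / R ^ 2) * (z - x) :=
      mul_le_mul_of_nonneg_right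
        (mul_le_mul_of_nonneg_left (hΨ.div_sq_mono hsq hz hzR) (by positivity)) hd.le

theorem potentialDeriv_of_nonneg {x : ℝ} (hx : 0 ≤ x) : potentialDeriv Ψ x = 2 * (Ψ x / x) := by
  rw [potentialDeriv, abs_of_nonneg hx, mul_div_assoc]

/-- The derivative of the potential is Lipschitz on bounded sets, with the natural constant. -/
theorem abs_potentialDeriv_sub_le (hΨ : ClassA α Ψ) (hconv : ConvexOn ℝ (Ici 0) Ψ)
    (hsq : ConvexOn ℝ (Ici 0) fun x => Ψ √x) {u v R : ℝ} (hu : |u| ≤ R) (hv : |v| ≤ R) :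
    |potentialDeriv Ψ u - potentialDeriv Ψ v| ≤ 2 * 2 ^ α * (Ψ R / R ^ 2) * |u - v| := by
  have hR : 0 ≤ R := (abs_nonneg u).trans hu
  have hpos : ∀ u v : ℝ, 0 ≤ u → u ≤ v → v ≤ R →
      |potentialDeriv Ψ v - potentialDeriv Ψ u| ≤ 2 * 2 ^ α * (Ψ R / R ^ 2) * (v - u) := by
    intro u v hu huv hvR
    rw [potentialDeriv_of_nonneg hu, potentialDeriv_of_nonneg (hu.trans huv), ← mul_sub,
      abs_of_nonneg (mul_nonneg two_pos.le (sub_nonneg.2 (hΨ.div_mono hconv hu huv)))]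
    have := hΨ.div_sub_div_le hconv hsq hu huv hvR
    linarith
  have hzero : potentialDeriv Ψ 0 = 0 := by simp [potentialDeriv]
  wlog huv : u ≤ v generalizing u v
  · rw [abs_sub_comm, abs_sub_comm u]
    exact this hv hu (le_of_not_ge huv)
  rw [abs_sub_comm, abs_sub_comm u, abs_of_nonneg (sub_nonneg.2 huv)]
  rcases le_total 0 u with h0 | h0
  · exact hpos u v h0 huv ((le_abs_self v).trans hv)
  rcases le_total v 0 with h1 | h1
  · have := hpos (-v) (-u) (by linarith) (by linarith) ((neg_le_abs u).trans hu)
    simp only [potentialDeriv_neg] at this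
    rwa [neg_sub_neg, neg_sub_neg] at this
  · have e1 := hpos 0 v le_rfl h1 ((le_abs_self v).trans hv)
    have e2 := hpos 0 (-u) le_rfl (by linarith) ((neg_le_abs u).trans hu)
    rw [potentialDeriv_neg, hzero, sub_zero, abs_neg] at e2
    rw [hzero, sub_zero] at e1
    have := abs_sub (potentialDeriv Ψ v) (potentialDeriv Ψ u)
    linarith

theorem continuous_potentialDeriv (hΨ : ClassA α Ψ) (hconv : ConvexOn ℝ (Ici 0) Ψ)
    (hsq : ConvexOn ℝ (Ici 0) fun x => Ψ √x) : Continuous (potentialDeriv Ψ) := by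
  rw [continuous_iff_continuousAt]
  intro x
  refine continuousAt_of_locally_lipschitz one_pos
    (2 * 2 ^ α * (Ψ (|x| + 1) / (|x| + 1) ^ 2)) fun y hy => ?_
  rw [Real.dist_eq] at hy ⊢
  rw [Real.dist_eq]
  refine hΨ.abs_potentialDeriv_sub_le hconv hsq ?_ (by linarith)
  have := abs_sub_abs_le_abs_sub y x
  linarith

theorem continuous_potential (hΨ : ClassA α Ψ) (hconv : ConvexOn ℝ (Ici 0) Ψ)
    (hsq : ConvexOn ℝ (Ici 0) fun x => Ψ √x) : Continuous (potential Ψ) :=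
  intervalIntegral.continuous_primitive
    (fun a b => (hΨ.continuous_potentialDeriv hconv hsq).intervalIntegrable a b) 0

theorem potential_le (hΨ : ClassA α Ψ) (hconv : ConvexOn ℝ (Ici 0) Ψ)
    (hsq : ConvexOn ℝ (Ici 0) fun x => Ψ √x) (x : ℝ) : potential Ψ x ≤ 2 * Ψ |x| := by
  rw [← potential_abs]
  have hx := abs_nonneg x
  generalize |x| = x at hx
  have h : potential Ψ x ≤ ∫ _ in (0 : ℝ)..x, 2 * (Ψ x / x) := by
    refine intervalIntegral.integral_mono_on hx
      ((hΨ.continuous_potentialDeriv hconv hsq).intervalIntegrable _ _) (by simp) fun u hu => ?_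
    rw [potentialDeriv_of_nonneg hu.1]
    have := hΨ.div_mono hconv hu.1 hu.2
    linarith
  refine h.trans ?_
  rw [intervalIntegral.integral_const, smul_eq_mul, sub_zero]
  rcases hx.eq_or_lt with rfl | hx
  · simp [hΨ.map_zero]
  · field_simp; rfl

theorem le_potential (hΨ : ClassA α Ψ) (hconv : ConvexOn ℝ (Ici 0) Ψ)
    (hsq : ConvexOn ℝ (Ici 0) fun x => Ψ √x) (x : ℝ) : 2 * Ψ |x| ≤ 2 ^ α * potential Ψ x := by
  rw [← potential_abs]
  have hx := abs_nonneg x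
  generalize |x| = x at hx
  rcases hx.eq_or_lt with rfl | hx
  · simp [hΨ.map_zero, potential_zero]
  have hint := fun a b =>
    (hΨ.continuous_potentialDeriv hconv hsq).intervalIntegrable (μ := volume) a b
  have h1 : 0 ≤ ∫ u in (0 : ℝ)..(x / 2), potentialDeriv Ψ u :=
    intervalIntegral.integral_nonneg (by positivity) fun u hu => by
      rw [potentialDeriv_of_nonneg hu.1]
      have := div_nonneg (hΨ.nonneg u hu.1) hu.1
      positivity
  have h2 : ∫ _ in (x / 2)..x, 2 * (Ψ (x / 2) / (x / 2)) ≤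
      ∫ u in (x / 2)..x, potentialDeriv Ψ u := by
    refine intervalIntegral.integral_mono_on (by linarith) (by simp) (hint _ _) fun u hu => ?_
    rw [potentialDeriv_of_nonneg (by linarith [hu.1])]
    have := hΨ.div_mono hconv (by positivity) hu.1
    linarith
  have h3 : potential Ψ x = _ :=
    (intervalIntegral.integral_add_adjacent_intervals (hint 0 (x / 2)) (hint (x / 2) x)).symm
  rw [intervalIntegral.integral_const, smul_eq_mul] at h2
  have h4 : (x - x / 2) * (2 * (Ψ (x / 2) / (x / 2))) = 2 * Ψ (x / 2) := by field_simp; ring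
  have h5 := hΨ.map_two_mul_le (x := x / 2) (by positivity)
  rw [mul_div_cancel₀ x two_ne_zero] at h5
  have h6 : 2 * Ψ (x / 2) ≤ potential Ψ x := by linarith
  calc 2 * Ψ x ≤ 2 ^ α * (2 * Ψ (x / 2)) := by linarith
    _ ≤ 2 ^ α * potential Ψ x := by gcongr

theorem potential_nonneg (hΨ : ClassA α Ψ) (hconv : ConvexOn ℝ (Ici 0) Ψ)
    (hsq : ConvexOn ℝ (Ici 0) fun x => Ψ √x) (x : ℝ) : 0 ≤ potential Ψ x := by
  have h := hΨ.le_potential hconv hsq x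
  have h0 := hΨ.map_abs_nonneg x
  have h2 : (0 : ℝ) < 2 ^ α := by positivity
  exact nonneg_of_mul_nonneg_right (by linarith : 0 ≤ 2 ^ α * potential Ψ x) h2

/-- The second-order inequality behind the martingale estimate. The factor `a ^ 2` in the
remainder, for an increment of size `a`, is what gives the space `L_Ψ` type two. -/
theorem potential_add_le (hΨ : ClassA α Ψ) (hconv : ConvexOn ℝ (Ici 0) Ψ)
    (hsq : ConvexOn ℝ (Ici 0) fun x => Ψ √x) {a : ℝ} (ha : |a| ≤ 1) (x z : ℝ) :
    potential Ψ (x + a * z) ≤ potential Ψ x + a * (potentialDeriv Ψ x * z) +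
      4 ^ α * a ^ 2 * (Ψ |x| + Ψ |z|) := by
  set N : ℝ := max |x| |z| with hN
  have hN0 : 0 ≤ N := (abs_nonneg x).trans (le_max_left _ _)
  have haz : |a * z| ≤ N := by
    rw [abs_mul]
    exact (mul_le_of_le_one_left (abs_nonneg z) ha).trans (le_max_right _ _)
  have hΨN : Ψ N ≤ Ψ |x| + Ψ |z| := by
    rcases max_choice |x| |z| with h | h <;> rw [hN, h]
    · linarith [hΨ.map_abs_nonneg z]
    · linarith [hΨ.map_abs_nonneg x]
  have hint := fun a b =>
    (hΨ.continuous_potentialDeriv hconv hsq).intervalIntegrable (μ := volume) a b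
  have hrem : potential Ψ (x + a * z) - potential Ψ x - a * (potentialDeriv Ψ x * z) =
      ∫ u in x..(x + a * z), (potentialDeriv Ψ u - potentialDeriv Ψ x) := by
    rw [intervalIntegral.integral_sub (hint _ _) (by simp), intervalIntegral.integral_const,
      potential, potential, ← intervalIntegral.integral_add_adjacent_intervals (hint 0 x)
        (hint x (x + a * z)), smul_eq_mul]
    ring
  have hbound : ‖∫ u in x..(x + a * z), (potentialDeriv Ψ u - potentialDeriv Ψ x)‖ ≤
      2 * 2 ^ α * (Ψ (2 * N) / (2 * N) ^ 2) * |a * z| * |x + a * z - x| := by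
    refine intervalIntegral.norm_integral_le_of_norm_le_const fun u hu => ?_
    have hux : |u - x| ≤ |a * z| := by
      have := abs_sub_left_of_mem_uIcc (uIoc_subset_uIcc hu)
      simpa using this
    have hxN : |x| ≤ N := le_max_left _ _
    have huN : |u| ≤ 2 * N := by
      have := abs_sub_abs_le_abs_sub u x
      linarith
    refine (hΨ.abs_potentialDeriv_sub_le hconv hsq huN (by linarith)).trans ?_
    have : 0 ≤ Ψ (2 * N) := hΨ.nonneg _ (by positivity)
    gcongr
  have h2 : 2 * 2 ^ α * (Ψ (2 * N) / (2 * N) ^ 2) * |a * z| * |x + a * z - x| ≤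
      4 ^ α * a ^ 2 * Ψ N := by
    rw [add_sub_cancel_left]
    rcases hN0.eq_or_lt with h | hNpos
    · rw [← h] at haz ⊢
      simp [abs_nonpos_iff.1 haz, hΨ.map_zero]
    have hz2 : |a * z| * |a * z| ≤ a ^ 2 * N ^ 2 := by
      rw [abs_mul_abs_self]
      have : |z| ≤ |N| := by rw [abs_of_nonneg hN0]; exact le_max_right _ _
      nlinarith [sq_le_sq.2 this, sq_nonneg a]
    have hΨ0 : 0 ≤ Ψ N := hΨ.nonneg _ hN0
    have h4 : (4 : ℝ) ^ α = 2 ^ α * 2 ^ α := by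
      rw [← Real.mul_rpow (by norm_num) (by norm_num)]; norm_num
    calc 2 * 2 ^ α * (Ψ (2 * N) / (2 * N) ^ 2) * |a * z| * |a * z|
        = 2 * 2 ^ α * (Ψ (2 * N) / (2 * N) ^ 2) * (|a * z| * |a * z|) := by ring
      _ ≤ 2 * 2 ^ α * (2 ^ α * Ψ N / (2 * N) ^ 2) * (a ^ 2 * N ^ 2) := by
          gcongr
          exact hΨ.map_two_mul_le hN0
      _ = 4 ^ α * a ^ 2 * Ψ N / 2 := by rw [h4]; field_simp
      _ ≤ 4 ^ α * a ^ 2 * Ψ N := half_le_self (by positivity)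
  have h3 := (Real.le_norm_self _).trans hbound
  rw [← hrem] at h3
  have h4 : 4 ^ α * a ^ 2 * Ψ N ≤ 4 ^ α * a ^ 2 * (Ψ |x| + Ψ |z|) := by gcongr
  linarith

theorem abs_potentialDeriv_mul_le (hΨ : ClassA α Ψ) (hconv : ConvexOn ℝ (Ici 0) Ψ) (x z : ℝ) :
    |potentialDeriv Ψ x * z| ≤ 2 * (Ψ |x| + Ψ |z|) := by
  have hx := abs_nonneg x
  have hz := abs_nonneg z
  have e : |potentialDeriv Ψ x * z| = 2 * (Ψ |x| / |x| * |z|) := by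
    rw [potentialDeriv, abs_mul, abs_div, abs_mul, abs_of_nonneg (hΨ.map_abs_nonneg x), abs_two]
    ring
  rw [e]
  have h0x := hΨ.map_abs_nonneg x
  have h0z := hΨ.map_abs_nonneg z
  gcongr
  rcases le_total |z| |x| with h | h
  · rcases hx.eq_or_lt with h0 | h0
    · rw [← h0]; simp [hΨ.map_zero, h0z]
    · have : Ψ |x| / |x| * |z| ≤ Ψ |x| / |x| * |x| := by gcongr
      rw [div_mul_cancel₀ _ h0.ne'] at this
      linarith
  · rcases hz.eq_or_lt with h0 | h0
    · rw [← h0]; simp [hΨ.map_zero, h0x]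
    · have : Ψ |x| / |x| * |z| ≤ Ψ |z| / |z| * |z| :=
        mul_le_mul_of_nonneg_right (hΨ.div_mono hconv hx h) hz
      rw [div_mul_cancel₀ _ h0.ne'] at this
      linarith

/-- Quasi-additivity of `Ψ`, from monotonicity and doubling. -/
theorem map_abs_add_le (hΨ : ClassA α Ψ) {a : ℝ} (ha : |a| ≤ 1) (x z : ℝ) :
    Ψ |x + a * z| ≤ 2 ^ α * (Ψ |x| + Ψ |z|) := by
  have hx := abs_nonneg x
  set N : ℝ := max |x| |z| with hN
  have hN0 : 0 ≤ N := hx.trans (le_max_left _ _)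
  have h : |x + a * z| ≤ 2 * N := by
    refine (abs_add_le _ _).trans ?_
    rw [abs_mul]
    have h1 : |x| ≤ N := le_max_left _ _
    have h2 : |a| * |z| ≤ N :=
      (mul_le_of_le_one_left (abs_nonneg z) ha).trans (le_max_right _ _)
    linarith
  refine (hΨ.mono_of_nonneg (abs_nonneg _) h).trans ((hΨ.map_two_mul_le hN0).trans ?_)
  gcongr
  rcases max_choice |x| |z| with h | h <;> rw [hN, h]
  · linarith [hΨ.map_abs_nonneg z]
  · linarith [hΨ.map_abs_nonneg x]

end ClassA

end Potential

/-! ### The martingale inequality in `L_Ψ` -/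

section Martingale

variable {Ω : Type*} {m mΩ : MeasurableSpace Ω} {μ : Measure Ω} {α : ℝ} {Ψ : ℝ → ℝ}

/-- The constant of the martingale inequality in `L_Ψ`, for `Ψ ∈ 𝒜_α`. -/
noncomputable def martConst (α : ℝ) : ℝ := 2 ^ α * Real.exp (8 ^ α)

theorem martConst_pos : 0 < martConst α := by unfold martConst; positivity

theorem one_le_martConst (hα : 0 < α) : 1 ≤ martConst α := by
  have h1 : (1 : ℝ) ≤ 2 ^ α := Real.one_le_rpow (by norm_num) hα.le
  have h2 : (1 : ℝ) ≤ Real.exp (8 ^ α) := Real.one_le_exp (by positivity)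
  unfold martConst
  nlinarith

theorem ClassA.integrable_potential (hΨ : ClassA α Ψ) (hconv : ConvexOn ℝ (Ici 0) Ψ)
    (hsq : ConvexOn ℝ (Ici 0) fun x => Ψ √x) {S : Ω → ℝ} (hS : AEStronglyMeasurable S μ)
    (hi : Integrable (fun ω => Ψ |S ω|) μ) : Integrable (fun ω => potential Ψ (S ω)) μ := by
  refine (hi.const_mul 2).mono'
    ((hΨ.continuous_potential hconv hsq).comp_aestronglyMeasurable hS) (ae_of_all _ fun ω => ?_)
  rw [Real.norm_of_nonneg (hΨ.potential_nonneg hconv hsq _)]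
  exact hΨ.potential_le hconv hsq _

/-- One step of the recursion: adding a martingale difference of size `a` multiplies
`𝔼 F(S) + 1`, with `F` the potential, by at most `1 + 8 ^ α a ^ 2`. -/
theorem integral_potential_add_le [IsProbabilityMeasure μ] (hα : 0 < α) (hΨ : ClassA α Ψ)
    (hconv : ConvexOn ℝ (Ici 0) Ψ) (hsq : ConvexOn ℝ (Ici 0) fun x => Ψ √x)
    (hm : m ≤ mΩ) {S Y : Ω → ℝ} (hS : StronglyMeasurable[m] S)
    (hSi : Integrable (fun ω => Ψ |S ω|) μ) (hY : Integrable Y μ)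
    (hYi : Integrable (fun ω => Ψ |Y ω|) μ) (hY1 : ∫ ω, Ψ |Y ω| ∂μ ≤ 1)
    (hcond : μ[Y | m] =ᵐ[μ] 0) {a : ℝ} (ha : |a| ≤ 1) :
    Integrable (fun ω => Ψ |S ω + a * Y ω|) μ ∧
      ∫ ω, potential Ψ (S ω + a * Y ω) ∂μ + 1 ≤
        (1 + 8 ^ α * a ^ 2) * (∫ ω, potential Ψ (S ω) ∂μ + 1) := by
  have hS' : AEStronglyMeasurable S μ := (hS.mono hm).aestronglyMeasurable
  have hSY : AEStronglyMeasurable (fun ω => S ω + a * Y ω) μ :=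
    hS'.add (hY.aestronglyMeasurable.const_mul a)
  have hint : Integrable (fun ω => Ψ |S ω + a * Y ω|) μ := by
    refine ((hSi.add hYi).const_mul (2 ^ α)).mono'
      (hΨ.continuous_comp_abs.comp_aestronglyMeasurable hSY) (ae_of_all _ fun ω => ?_)
    rw [Real.norm_of_nonneg (hΨ.map_abs_nonneg _)]
    exact hΨ.map_abs_add_le ha _ _
  refine ⟨hint, ?_⟩
  have hGm : StronglyMeasurable[m] (fun ω => potentialDeriv Ψ (S ω)) :=
    (hΨ.continuous_potentialDeriv hconv hsq).comp_stronglyMeasurable hS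
  have hGY : Integrable (fun ω => potentialDeriv Ψ (S ω) * Y ω) μ := by
    refine ((hSi.add hYi).const_mul 2).mono'
      ((hGm.mono hm).aestronglyMeasurable.mul hY.aestronglyMeasurable) (ae_of_all _ fun ω => ?_)
    exact hΨ.abs_potentialDeriv_mul_le hconv _ _
  -- the first-order term has mean zero by the martingale property
  have hGY0 : ∫ ω, potentialDeriv Ψ (S ω) * Y ω ∂μ = 0 := by
    rw [← integral_condExp hm]
    refine integral_eq_zero_of_ae ?_
    filter_upwards [condExp_mul_of_stronglyMeasurable_left hGm hGY hY, hcond] with ω h1 h2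
    refine h1.trans ?_
    simp [h2]
  have hF := hΨ.integrable_potential hconv hsq hS' hSi
  have hle : ∫ ω, potential Ψ (S ω + a * Y ω) ∂μ ≤
      ∫ ω, potential Ψ (S ω) ∂μ + 4 ^ α * a ^ 2 * (∫ ω, Ψ |S ω| ∂μ + ∫ ω, Ψ |Y ω| ∂μ) := by
    have hI1 : Integrable (fun ω => potential Ψ (S ω) + a * (potentialDeriv Ψ (S ω) * Y ω)) μ :=
      hF.add (hGY.const_mul a)
    have hI2 : Integrable (fun ω => 4 ^ α * a ^ 2 * (Ψ |S ω| + Ψ |Y ω|)) μ :=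
      (hSi.add hYi).const_mul _
    refine (integral_mono (hΨ.integrable_potential hconv hsq hSY hint) (hI1.add hI2)
      fun ω => hΨ.potential_add_le hconv hsq ha (S ω) (Y ω)).trans_eq ?_
    rw [integral_add' hI1 hI2, integral_add hF (hGY.const_mul a), integral_const_mul,
      integral_const_mul, integral_add hSi hYi, hGY0]
    ring
  have hΨF : ∫ ω, Ψ |S ω| ∂μ ≤ 2 ^ α * ∫ ω, potential Ψ (S ω) ∂μ := by
    rw [← integral_const_mul]
    refine integral_mono hSi (hF.const_mul _) fun ω => ?_
    have := hΨ.le_potential hconv hsq (S ω)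
    have := hΨ.map_abs_nonneg (S ω)
    show Ψ |S ω| ≤ 2 ^ α * potential Ψ (S ω)
    linarith
  have hF0 : 0 ≤ ∫ ω, potential Ψ (S ω) ∂μ :=
    integral_nonneg fun ω => hΨ.potential_nonneg hconv hsq _
  have h2 : (1 : ℝ) ≤ 2 ^ α := Real.one_le_rpow (by norm_num) hα.le
  have h8 : (8 : ℝ) ^ α = 4 ^ α * 2 ^ α := by
    rw [← Real.mul_rpow (by norm_num) (by norm_num)]; norm_num
  have h3 : ∫ ω, Ψ |S ω| ∂μ + ∫ ω, Ψ |Y ω| ∂μ ≤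
      2 ^ α * (∫ ω, potential Ψ (S ω) ∂μ + 1) := by linarith
  have h4 : 4 ^ α * a ^ 2 * (∫ ω, Ψ |S ω| ∂μ + ∫ ω, Ψ |Y ω| ∂μ) ≤
      4 ^ α * a ^ 2 * (2 ^ α * (∫ ω, potential Ψ (S ω) ∂μ + 1)) := by gcongr
  rw [h8]
  linarith

/-- Weighted sums of martingale differences with normalized modulars: iterating the recursion over
the times in increasing order bounds `𝔼 F(S) + 1` by `∏ (1 + 8 ^ α a_j ^ 2)`, and
`1 + x ≤ exp x`. -/
theorem integral_potential_sum_le [IsProbabilityMeasure μ] (hα : 0 < α) (hΨ : ClassA α Ψ)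
    (hconv : ConvexOn ℝ (Ici 0) Ψ) (hsq : ConvexOn ℝ (Ici 0) fun x => Ψ √x)
    {ℱ : ℤ → MeasurableSpace Ω} (hmono : Monotone ℱ) (hle : ∀ j, ℱ j ≤ mΩ) {Y : ℤ → Ω → ℝ}
    (hYm : ∀ j, StronglyMeasurable[ℱ j] (Y j)) (hY : ∀ j, Integrable (Y j) μ)
    (hYi : ∀ j, Integrable (fun ω => Ψ |Y j ω|) μ) (hY1 : ∀ j, ∫ ω, Ψ |Y j ω| ∂μ ≤ 1)
    (hcond : ∀ j, μ[Y j | ℱ (j - 1)] =ᵐ[μ] 0) {a : ℤ → ℝ} (t : Finset ℤ)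
    (ha : ∀ j ∈ t, |a j| ≤ 1) :
    Integrable (fun ω => Ψ |∑ j ∈ t, a j * Y j ω|) μ ∧
      ∫ ω, potential Ψ (∑ j ∈ t, a j * Y j ω) ∂μ + 1 ≤ Real.exp (8 ^ α * ∑ j ∈ t, a j ^ 2) := by
  induction t using Finset.induction_on_max with
  | empty => simp [hΨ.map_zero, potential_zero]
  | insert k s hk ih =>
    obtain ⟨hi, hb⟩ := ih fun j hj => ha j (Finset.mem_insert_of_mem hj)
    have hks : k ∉ s := fun h => lt_irrefl _ (hk k h)
    have hSm : StronglyMeasurable[ℱ (k - 1)] (fun ω => ∑ j ∈ s, a j * Y j ω) :=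
      Finset.stronglyMeasurable_fun_sum s fun j hj =>
        ((hYm j).mono (hmono (by have := hk j hj; omega))).const_mul (a j)
    obtain ⟨h1, h2⟩ := integral_potential_add_le hα hΨ hconv hsq (hle (k - 1)) hSm hi (hY k)
      (hYi k) (hY1 k) (hcond k) (ha k (Finset.mem_insert_self _ _))
    have e : ∀ ω, ∑ j ∈ insert k s, a j * Y j ω = ∑ j ∈ s, a j * Y j ω + a k * Y k ω :=
      fun ω => by rw [Finset.sum_insert hks, add_comm]
    simp only [e]
    refine ⟨h1, h2.trans ?_⟩
    rw [Finset.sum_insert hks, mul_add (8 ^ α : ℝ), Real.exp_add]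
    have h3 := Real.add_one_le_exp (8 ^ α * a k ^ 2)
    have h4 : 0 ≤ ∫ ω, potential Ψ (∑ j ∈ s, a j * Y j ω) ∂μ :=
      integral_nonneg fun ω => hΨ.potential_nonneg hconv hsq _
    exact mul_le_mul (by linarith) hb (by linarith) (Real.exp_pos _).le

/-- The martingale inequality in `L_Ψ`: for martingale differences of norm at most `θ`, weighted
sums are bounded by `θ` times the `ℓ²`-norm of the weights. -/
theorem orliczNorm_sum_martingale_le [IsProbabilityMeasure μ] (hα : 0 < α) (hΨ : ClassA α Ψ)
    (hconv : ConvexOn ℝ (Ici 0) Ψ) (hsq : ConvexOn ℝ (Ici 0) fun x => Ψ √x)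
    {ℱ : ℤ → MeasurableSpace Ω} (hmono : Monotone ℱ) (hle : ∀ j, ℱ j ≤ mΩ) {Y : ℤ → Ω → ℝ}
    (hYm : ∀ j, StronglyMeasurable[ℱ j] (Y j)) (hY : ∀ j, Integrable (Y j) μ)
    (hcond : ∀ j, μ[Y j | ℱ (j - 1)] =ᵐ[μ] 0) {θ : ℝ≥0∞} (hθ : ∀ j, orliczNorm Ψ μ (Y j) ≤ θ)
    (a : ℤ → ℝ) (t : Finset ℤ) :
    orliczNorm Ψ μ (fun ω => ∑ j ∈ t, a j * Y j ω) ≤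
      ENNReal.ofReal (martConst α * √(∑ j ∈ t, a j ^ 2)) * θ := by
  set A : ℝ := √(∑ j ∈ t, a j ^ 2) with hA
  have hsum0 : 0 ≤ ∑ j ∈ t, a j ^ 2 := Finset.sum_nonneg fun j _ => sq_nonneg _
  have haA : ∀ j ∈ t, |a j| ≤ A := fun j hj => by
    rw [hA, ← Real.sqrt_sq_eq_abs]
    exact Real.sqrt_le_sqrt (Finset.single_le_sum (fun j _ => sq_nonneg (a j)) hj)
  rcases (Real.sqrt_nonneg (∑ j ∈ t, a j ^ 2)).eq_or_lt with h0 | hApos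
  · rw [← hA] at h0
    have : (fun ω => ∑ j ∈ t, a j * Y j ω) = fun _ => 0 := by
      funext ω
      refine Finset.sum_eq_zero fun j hj => ?_
      have := haA j hj
      rw [← h0] at this
      rw [abs_nonpos_iff.1 this, zero_mul]
    rw [this, orliczNorm_zero hΨ]
    exact bot_le
  rw [← hA] at hApos
  have hK := martConst_pos (α := α)
  have hKA : 0 < martConst α * A := mul_pos hK hApos
  refine ENNReal.le_of_forall_pos_le_add fun ε hε hfin => ?_
  have hθtop : θ ≠ ∞ := by
    rintro rfl
    rw [ENNReal.mul_top (by simpa using hKA)] at hfin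
    exact hfin.ne rfl
  set c : ℝ := θ.toReal + ε / (martConst α * A) with hc
  have hε' : (0 : ℝ) < ε := hε
  have hcpos : 0 < c := add_pos_of_nonneg_of_pos ENNReal.toReal_nonneg (div_pos hε' hKA)
  have hcof : ENNReal.ofReal c = θ + ENNReal.ofReal (ε / (martConst α * A)) := by
    rw [hc, ENNReal.ofReal_add ENNReal.toReal_nonneg (div_pos hε' hKA).le,
      ENNReal.ofReal_toReal hθtop]
  have htarget : ENNReal.ofReal (martConst α * A * c) =
      ENNReal.ofReal (martConst α * A) * θ + ε := by
    rw [ENNReal.ofReal_mul hKA.le, hcof, mul_add, ← ENNReal.ofReal_mul hKA.le,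
      mul_div_cancel₀ _ hKA.ne', ENNReal.ofReal_coe_nnreal]
  rw [← htarget]
  -- normalize the differences by `c > θ` and the weights by `A`
  have habs : ∀ j ω, |c⁻¹ * Y j ω| = |Y j ω| / c := fun j ω => by
    rw [abs_mul, abs_inv, abs_of_pos hcpos, inv_mul_eq_div]
  have hmod : ∀ j, ∫⁻ ω, ENNReal.ofReal (Ψ |c⁻¹ * Y j ω|) ∂μ ≤ 1 := fun j => by
    simp only [habs]
    refine orliczModular_le_one_of_norm_lt hΨ ((hθ j).trans_lt ?_)
    rw [hcof]
    exact ENNReal.lt_add_right hθtop (by simpa using div_pos hε' hKA)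
  have hmeas : ∀ j, AEStronglyMeasurable (fun ω => Ψ |c⁻¹ * Y j ω|) μ := fun j =>
    hΨ.continuous_comp_abs.comp_aestronglyMeasurable ((hY j).aestronglyMeasurable.const_mul c⁻¹)
  have hYi : ∀ j, Integrable (fun ω => Ψ |c⁻¹ * Y j ω|) μ := fun j =>
    (lintegral_ofReal_ne_top_iff_integrable (hmeas j)
      (ae_of_all _ fun ω => hΨ.map_abs_nonneg _)).1 ((hmod j).trans_lt ENNReal.one_lt_top).ne
  have hY1 : ∀ j, ∫ ω, Ψ |c⁻¹ * Y j ω| ∂μ ≤ 1 := fun j => by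
    rw [← ENNReal.ofReal_le_one, ofReal_integral_eq_lintegral_ofReal (hYi j)
      (ae_of_all _ fun ω => hΨ.map_abs_nonneg _)]
    exact hmod j
  have hcond' : ∀ j, μ[fun ω => c⁻¹ * Y j ω | ℱ (j - 1)] =ᵐ[μ] 0 := fun j => by
    have := condExp_smul (μ := μ) c⁻¹ (Y j) (ℱ (j - 1))
    filter_upwards [this, hcond j] with ω h1 h2
    refine h1.trans ?_
    simp [h2]
  obtain ⟨hi, hb⟩ := integral_potential_sum_le hα hΨ hconv hsq hmono hle
    (Y := fun j ω => c⁻¹ * Y j ω) (fun j => (hYm j).const_mul _) (fun j => (hY j).const_mul _)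
    hYi hY1 hcond' (a := fun j => a j / A) t fun j hj => by
      rw [abs_div, abs_of_pos hApos]
      exact (div_le_one hApos).2 (haA j hj)
  have hone : ∑ j ∈ t, (a j / A) ^ 2 = 1 := by
    simp only [div_pow]
    rw [← Finset.sum_div, hA, Real.sq_sqrt hsum0, div_self]
    exact (Real.sqrt_pos.1 hApos).ne'
  rw [hone, mul_one] at hb
  have hSm : AEStronglyMeasurable (fun ω => ∑ j ∈ t, a j / A * (c⁻¹ * Y j ω)) μ :=
    Finset.aestronglyMeasurable_fun_sum t fun j _ =>
      ((hY j).aestronglyMeasurable.const_mul _).const_mul _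
  have hΨS : ∫ ω, Ψ |∑ j ∈ t, a j / A * (c⁻¹ * Y j ω)| ∂μ ≤ martConst α := by
    have h1 : ∫ ω, Ψ |∑ j ∈ t, a j / A * (c⁻¹ * Y j ω)| ∂μ ≤
        2 ^ α * ∫ ω, potential Ψ (∑ j ∈ t, a j / A * (c⁻¹ * Y j ω)) ∂μ := by
      rw [← integral_const_mul]
      refine integral_mono hi ((hΨ.integrable_potential hconv hsq hSm hi).const_mul _) fun ω => ?_
      have := hΨ.le_potential hconv hsq (∑ j ∈ t, a j / A * (c⁻¹ * Y j ω))
      have := hΨ.map_abs_nonneg (∑ j ∈ t, a j / A * (c⁻¹ * Y j ω))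
      show Ψ |∑ j ∈ t, a j / A * (c⁻¹ * Y j ω)| ≤
        2 ^ α * potential Ψ (∑ j ∈ t, a j / A * (c⁻¹ * Y j ω))
      linarith
    refine h1.trans ?_
    unfold martConst
    gcongr
    linarith
  refine orliczNorm_le_of_modular (mul_pos hKA hcpos) ?_
  have hpt : ∀ ω, Ψ (|∑ j ∈ t, a j * Y j ω| / (martConst α * A * c)) ≤
      (martConst α)⁻¹ * Ψ |∑ j ∈ t, a j / A * (c⁻¹ * Y j ω)| := fun ω => by
    have e : |∑ j ∈ t, a j * Y j ω| / (martConst α * A * c) =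
        (martConst α)⁻¹ * |∑ j ∈ t, a j / A * (c⁻¹ * Y j ω)| := by
      have : ∑ j ∈ t, a j / A * (c⁻¹ * Y j ω) = (A * c)⁻¹ * ∑ j ∈ t, a j * Y j ω := by
        rw [Finset.mul_sum]
        refine Finset.sum_congr rfl fun j _ => ?_
        field_simp
      rw [this, abs_mul, abs_of_pos (inv_pos.2 (mul_pos hApos hcpos))]
      field_simp
    rw [e]
    exact hΨ.map_mul_le hconv (inv_pos.2 hK).le (inv_le_one_of_one_le₀ (one_le_martConst hα))
      (abs_nonneg _)
  calc orliczModular Ψ μ (fun ω => ∑ j ∈ t, a j * Y j ω) (martConst α * A * c)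
      ≤ ∫⁻ ω, ENNReal.ofReal ((martConst α)⁻¹ * Ψ |∑ j ∈ t, a j / A * (c⁻¹ * Y j ω)|) ∂μ :=
        lintegral_mono fun ω => ENNReal.ofReal_le_ofReal (hpt ω)
    _ = ENNReal.ofReal ((martConst α)⁻¹ * ∫ ω, Ψ |∑ j ∈ t, a j / A * (c⁻¹ * Y j ω)| ∂μ) := by
        rw [← integral_const_mul, ofReal_integral_eq_lintegral_ofReal (hi.const_mul _)
          (ae_of_all _ fun ω => mul_nonneg (inv_pos.2 hK).le (hΨ.map_abs_nonneg _))]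
    _ ≤ 1 := by
        rw [ENNReal.ofReal_le_one, inv_mul_le_iff₀ hK, mul_one]
        exact hΨS

end Martingale

/-! ### The Cauchy criterion for series in `L_Ψ` -/

section Cauchy

variable {Ω : Type*} {mΩ : MeasurableSpace Ω} {μ : Measure Ω} {α : ℝ} {Ψ : ℝ → ℝ}

theorem integrable_of_orliczNorm_lt_top [IsProbabilityMeasure μ] (hΨ : ClassA α Ψ)
    (hconv : ConvexOn ℝ (Ici 0) Ψ) (hne : ∃ x : ℝ, 0 ≤ x ∧ Ψ x ≠ 0) {X : Ω → ℝ}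
    (hX : AEMeasurable X μ) (h : orliczNorm Ψ μ X < ∞) : Integrable X μ := by
  obtain ⟨K, -, hK⟩ := exists_lintegral_le_orliczNorm (μ := μ) hΨ hconv hne
  exact ⟨hX.aestronglyMeasurable, (hK X hX).trans_lt (ENNReal.mul_lt_top ENNReal.ofReal_lt_top h)⟩

/-- Completeness of `L_Ψ`, in the form needed here: the limit exists in `L¹`, and lower
semicontinuity of the norm turns it into a limit in `L_Ψ`. -/
theorem exists_orliczHasSum [IsProbabilityMeasure μ] (hΨ : ClassA α Ψ)
    (hconv : ConvexOn ℝ (Ici 0) Ψ) (hne : ∃ x : ℝ, 0 ≤ x ∧ Ψ x ≠ 0) {ι : Type*} [Countable ι]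
    {X : ι → Ω → ℝ} (hX : ∀ i, AEMeasurable (X i) μ) (hfin : ∀ i, orliczNorm Ψ μ (X i) < ∞)
    (hC : ∀ ε : ℝ, 0 < ε → ∃ s : Finset ι, ∀ t, Disjoint t s →
      orliczNorm Ψ μ (fun ω => ∑ i ∈ t, X i ω) ≤ ENNReal.ofReal ε) :
    ∃ S, OrliczHasSum Ψ μ X S := by
  classical
  obtain ⟨K, hK0, hK⟩ := exists_lintegral_le_orliczNorm (μ := μ) hΨ hconv hne
  have hint : ∀ i, Integrable (X i) μ := fun i =>
    integrable_of_orliczNorm_lt_top hΨ hconv hne (hX i) (hfin i)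
  have hsumm : ∀ s : Finset ι, AEMeasurable (fun ω => ∑ i ∈ s, X i ω) μ := fun s =>
    Finset.aemeasurable_fun_sum s fun i _ => hX i
  set f : ι → Lp ℝ 1 μ := fun i => (hint i).toL1 (X i) with hf
  have hcoe : ∀ s : Finset ι, ∀ᵐ ω ∂μ, (∑ i ∈ s, f i : Lp ℝ 1 μ) ω = ∑ i ∈ s, X i ω := by
    intro s
    have h1 : ∀ᵐ ω ∂μ, ∀ i ∈ s, f i ω = X i ω :=
      (ae_ball_iff s.countable_toSet).2 fun i _ => (hint i).coeFn_toL1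
    filter_upwards [h1, Lp.coeFn_finsetSum s f] with ω h1 h2
    rw [h2, Finset.sum_apply, Finset.sum_congr rfl h1]
  have hsummable : Summable f := by
    rw [summable_iff_vanishing_norm]
    intro ε hε
    obtain ⟨s, hs⟩ := hC (ε / (2 * (K + 1))) (by positivity)
    refine ⟨s, fun t ht => ?_⟩
    have h1 : ∫⁻ ω, ‖∑ i ∈ t, X i ω‖ₑ ∂μ ≤ ENNReal.ofReal (ε / 2) := by
      refine (hK _ (hsumm t)).trans ?_
      calc ENNReal.ofReal K * orliczNorm Ψ μ (fun ω => ∑ i ∈ t, X i ω)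
          ≤ ENNReal.ofReal (K + 1) * ENNReal.ofReal (ε / (2 * (K + 1))) := by
            gcongr
            · linarith
            · exact hs t ht
        _ = ENNReal.ofReal (ε / 2) := by
            rw [← ENNReal.ofReal_mul (by positivity)]
            congr 1
            field_simp
    rw [Lp.norm_def, eLpNorm_one_eq_lintegral_enorm,
      lintegral_congr_ae ((hcoe t).mono fun ω h => by rw [h])]
    refine (ENNReal.toReal_le_of_le_ofReal (by positivity) h1).trans_lt (by linarith)
  obtain ⟨g, hg⟩ := hsummable
  obtain ⟨ns, hns, hlim⟩ := (tendstoInMeasure_of_tendsto_Lp hg).exists_seq_tendsto_ae'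
  have hlim' : ∀ᵐ ω ∂μ, Tendsto (fun n => ∑ i ∈ ns n, X i ω) atTop (𝓝 (g ω)) := by
    filter_upwards [hlim, ae_all_iff.2 fun n => hcoe (ns n)] with ω h1 h2
    exact h1.congr h2
  have hgm : AEMeasurable (g : Ω → ℝ) μ := (Lp.aestronglyMeasurable g).aemeasurable
  have key : ∀ ε : ℝ, 0 < ε → ∃ s₀ : Finset ι, ∀ s, s₀ ⊆ s →
      orliczNorm Ψ μ (fun ω => (∑ i ∈ s, X i ω) - g ω) ≤ ENNReal.ofReal ε := by
    intro ε hε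
    obtain ⟨s₀, hs₀⟩ := hC ε hε
    refine ⟨s₀, fun s hs => ?_⟩
    rw [orliczNorm_sub_comm hΨ]
    refine orliczNorm_le_of_tendsto hΨ (X := fun n ω => ∑ i ∈ ns n, X i ω - ∑ i ∈ s, X i ω)
      (fun n => (hsumm _).sub (hsumm _))
      (hlim'.mono fun ω h => h.sub_const _) ?_
    filter_upwards [hns.eventually_ge_atTop s] with n hn
    have e : (fun ω => ∑ i ∈ ns n, X i ω - ∑ i ∈ s, X i ω) =
        fun ω => ∑ i ∈ ns n \ s, X i ω := by
      funext ω
      rw [← Finset.sum_sdiff hn, add_sub_cancel_right]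
    rw [e]
    exact hs₀ _ (Finset.sdiff_disjoint.mono_right hs)
  refine ⟨g, (memOrlicz_iff hΨ hconv).2 ⟨hgm, ?_⟩, ?_⟩
  · obtain ⟨s, hs⟩ := key 1 one_pos
    have h1 := orliczNorm_add_le hΨ hconv (X := fun ω => ∑ i ∈ s, X i ω)
      (Y := fun ω => g ω - ∑ i ∈ s, X i ω) (μ := μ) (hsumm s) (hgm.sub (hsumm s))
    simp only [add_sub_cancel] at h1
    rw [orliczNorm_sub_comm hΨ] at h1
    refine h1.trans_lt (ENNReal.add_lt_top.2
      ⟨?_, (hs s subset_rfl).trans_lt ENNReal.ofReal_lt_top⟩)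
    have h2 := orliczNorm_le_tsum hΨ hconv (X := fun (i : s) => X i)
      (S := fun ω => ∑ i ∈ s, X i ω) (μ := μ) (fun i => hX i) (ae_of_all _ fun ω => by
        rw [← Finset.sum_coe_sort]
        exact hasSum_fintype _)
    refine h2.trans_lt ?_
    rw [tsum_fintype]
    exact ENNReal.sum_lt_top.2 fun i _ => hfin i
  · rw [ENNReal.tendsto_nhds_zero]
    intro ε hε
    obtain ⟨δ, hδ0, hδ⟩ := ENNReal.lt_iff_exists_nnreal_btwn.1 hε
    obtain ⟨s, hs⟩ := key δ (by simpa using hδ0)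
    filter_upwards [eventually_ge_atTop s] with t ht
    exact (hs t ht).trans (by simpa using hδ.le)

/-- An absolutely convergent series in `L_Ψ` converges to its pointwise sum. -/
theorem orliczHasSum_tsum [IsProbabilityMeasure μ] (hΨ : ClassA α Ψ)
    (hconv : ConvexOn ℝ (Ici 0) Ψ) {ι : Type*} [Countable ι]
    {X : ι → Ω → ℝ} (hX : ∀ i, AEMeasurable (X i) μ) (hfin : ∑' i, orliczNorm Ψ μ (X i) < ∞)
    (hsum : ∀ᵐ ω ∂μ, Summable fun i => X i ω) :
    OrliczHasSum Ψ μ X fun ω => ∑' i, X i ω := by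
  have hS : ∀ᵐ ω ∂μ, HasSum (fun i => X i ω) (∑' i, X i ω) := hsum.mono fun ω h => h.hasSum
  have hSm : AEMeasurable (fun ω => ∑' i, X i ω) μ :=
    aemeasurable_of_tendsto_metrizable_ae (ι := Finset ι) atTop
      (fun s => Finset.aemeasurable_fun_sum s fun i _ => hX i) hS
  refine ⟨(memOrlicz_iff hΨ hconv).2 ⟨hSm, (orliczNorm_le_tsum hΨ hconv hX hS).trans_lt hfin⟩, ?_⟩
  refine tendsto_of_tendsto_of_tendsto_of_le_of_le tendsto_const_nhds
    (ENNReal.tendsto_tsum_compl_atTop_zero hfin.ne) (fun _ => bot_le) fun s => ?_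
  rw [orliczNorm_sub_comm hΨ]
  refine orliczNorm_le_tsum hΨ hconv (X := fun i : {i // i ∉ s} => X i) (fun i => hX i) ?_
  filter_upwards [hS] with ω hω
  exact (Finset.hasSum_compl_iff (f := fun i => X i ω) s).2 (by rwa [sub_add_cancel])

/-- An absolutely convergent series in `L_Ψ` converges absolutely almost everywhere, with
integrable sum of absolute values. -/
theorem integrable_tsum_abs [IsProbabilityMeasure μ] (hΨ : ClassA α Ψ)
    (hconv : ConvexOn ℝ (Ici 0) Ψ) (hne : ∃ x : ℝ, 0 ≤ x ∧ Ψ x ≠ 0) {ι : Type*} [Countable ι]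
    {X : ι → Ω → ℝ} (hX : ∀ i, AEMeasurable (X i) μ) (hfin : ∑' i, orliczNorm Ψ μ (X i) < ∞) :
    (∀ᵐ ω ∂μ, Summable fun i => |X i ω|) ∧ Integrable (fun ω => ∑' i, |X i ω|) μ := by
  obtain ⟨K, -, hK⟩ := exists_lintegral_le_orliczNorm (μ := μ) hΨ hconv hne
  have hlt : ∫⁻ ω, ∑' i, ‖X i ω‖ₑ ∂μ < ∞ := by
    rw [lintegral_tsum fun i => (hX i).enorm]
    refine (ENNReal.tsum_le_tsum fun i => hK _ (hX i)).trans_lt ?_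
    rw [ENNReal.tsum_mul_left]
    exact ENNReal.mul_lt_top ENNReal.ofReal_lt_top hfin
  have hm : AEMeasurable (fun ω => ∑' i, ‖X i ω‖ₑ) μ :=
    AEMeasurable.tsum fun i => (hX i).enorm
  have hae := ae_lt_top' hm hlt.ne
  have e : ∀ ω, ∑' i, |X i ω| = (∑' i, ‖X i ω‖ₑ).toReal := fun ω => by
    rw [ENNReal.tsum_toReal_eq fun i => enorm_ne_top]
    simp
  refine ⟨hae.mono fun ω h => ?_, ?_⟩
  · have := ENNReal.summable_toReal h.ne
    simpa using this
  · simp only [e]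
    exact integrable_toReal_of_lintegral_ne_top hm hlt.ne

end Cauchy

/-! ### The `ℓ²`-norm of differences of a sequence -/

/-- The `ℓ²`-norm of a sequence indexed by `ℤ`, meaningful when the squares are summable. -/
noncomputable def l2Norm (f : ℤ → ℝ) : ℝ := √(∑' i, f i ^ 2)

section L2

variable {f g : ℤ → ℝ}

theorem l2Norm_nonneg : 0 ≤ l2Norm f := Real.sqrt_nonneg _

theorem l2_add_le (hf : Summable fun i => f i ^ 2) (hg : Summable fun i => g i ^ 2) :
    (Summable fun i => (f i + g i) ^ 2) ∧ l2Norm (fun i => f i + g i) ≤ l2Norm f + l2Norm g := by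
  have h := Real.Lp_add_le_tsum_of_nonneg (p := 2) (f := fun i => |f i|) (g := fun i => |g i|)
    one_le_two (fun i => abs_nonneg _) (fun i => abs_nonneg _)
    (by simpa using hf) (by simpa using hg)
  simp only [Real.rpow_two, sq_abs, ← Real.sqrt_eq_rpow] at h
  have hle : ∀ i, (f i + g i) ^ 2 ≤ (|f i| + |g i|) ^ 2 := fun i => by
    rw [← sq_abs]
    gcongr
    exact abs_add_le _ _
  have hs := Summable.of_nonneg_of_le (fun i => sq_nonneg _) hle h.1
  exact ⟨hs, (Real.sqrt_le_sqrt (hs.tsum_le_tsum hle h.1)).trans h.2⟩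

theorem summable_sq_shift (hf : Summable fun i => f i ^ 2) (k : ℤ) :
    Summable fun i => f (i + k) ^ 2 :=
  (Equiv.addRight k).summable_iff (f := fun i => f i ^ 2) |>.2 hf

theorem l2Norm_shift (k : ℤ) : l2Norm (fun i => f (i + k)) = l2Norm f := by
  rw [l2Norm, l2Norm]
  congr 1
  exact (Equiv.addRight k).tsum_eq (fun i => f i ^ 2)

theorem l2Norm_neg : l2Norm (fun i => -f i) = l2Norm f := by simp [l2Norm]

theorem l2_sub_le (hf : Summable fun i => f i ^ 2) (hg : Summable fun i => g i ^ 2) :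
    (Summable fun i => (f i - g i) ^ 2) ∧ l2Norm (fun i => f i - g i) ≤ l2Norm f + l2Norm g := by
  have h := l2_add_le (f := f) (g := fun i => -g i) hf (by simpa using hg)
  rw [l2Norm_neg] at h
  simpa only [← sub_eq_add_neg] using h

theorem l2Norm_shift_sub_le_two (hf : Summable fun i => f i ^ 2) (k : ℤ) :
    l2Norm (fun i => f (i + k) - f i) ≤ 2 * l2Norm f := by
  have := (l2_sub_le (summable_sq_shift hf k) hf).2
  rw [l2Norm_shift] at this
  linarith

theorem l2Norm_shift_nat_sub_le (hf : Summable fun i => f i ^ 2) (k : ℕ) :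
    l2Norm (fun i => f (i + k) - f i) ≤ k * l2Norm (fun i => f i - f (i - 1)) := by
  have hd : Summable fun i => (f i - f (i - 1)) ^ 2 :=
    (l2_sub_le hf (summable_sq_shift hf (-1))).1
  induction k with
  | zero => simp [l2Norm]
  | succ k ih =>
    have h := (l2_add_le (summable_sq_shift hd (k + 1 : ℤ))
      (l2_sub_le (summable_sq_shift hf k) hf).1).2
    rw [l2Norm_shift (f := fun i => f i - f (i - 1))] at h
    have e : ∀ i : ℤ, f (i + (k + 1)) - f (i + (k + 1) - 1) + (f (i + k) - f i) =
        f (i + ((k + 1 : ℕ) : ℤ)) - f i := fun i => by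
      rw [show i + ((k : ℤ) + 1) - 1 = i + k by ring]
      push_cast
      ring
    simp only [e] at h
    push_cast at h ⊢
    linarith

theorem l2Norm_shift_sub_le (hf : Summable fun i => f i ^ 2) (k : ℤ) :
    l2Norm (fun i => f (i + k) - f i) ≤ |(k : ℝ)| * l2Norm (fun i => f i - f (i - 1)) := by
  obtain ⟨n, rfl | rfl⟩ := k.eq_nat_or_neg
  · simpa using l2Norm_shift_nat_sub_le hf n
  · have h := l2Norm_shift_nat_sub_le hf n
    have e := l2Norm_shift (f := fun i => f (i + n) - f i) (-(n : ℤ))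
    rw [← l2Norm_neg] at e
    simp only [neg_add_cancel_right, neg_sub] at e
    rw [e]
    simpa using h

theorem summable_sq_indicator (hf : Summable fun i => f i ^ 2) (s : Set ℤ) :
    Summable fun i => s.indicator f i ^ 2 := by
  have := hf.indicator s
  refine this.congr fun i => ?_
  by_cases h : i ∈ s <;> simp [h]

theorem l2Norm_indicator_le (hf : Summable fun i => f i ^ 2) (s : Set ℤ) :
    l2Norm (s.indicator f) ≤ l2Norm f := by
  refine Real.sqrt_le_sqrt ((summable_sq_indicator hf s).tsum_le_tsum (fun i => ?_) hf)
  by_cases h : i ∈ s <;> simp [h, sq_nonneg]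

theorem tendsto_l2Norm_indicator_compl :
    Tendsto (fun s : Finset ℤ => l2Norm ((s : Set ℤ)ᶜ.indicator f)) atTop (𝓝 0) := by
  have h := tendsto_tsum_compl_atTop_zero fun i => f i ^ 2
  have e : ∀ s : Finset ℤ, l2Norm ((s : Set ℤ)ᶜ.indicator f) =
      √(∑' i : {i // i ∉ s}, f i ^ 2) := fun s => by
    rw [l2Norm]
    congr 1
    have : ∑' i : {i // i ∉ s}, f i ^ 2 = _ := tsum_subtype ((s : Set ℤ)ᶜ) fun i => f i ^ 2
    rw [this]
    refine tsum_congr fun i => ?_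
    by_cases h : i ∈ s <;> simp [h]
  simp only [e]
  simpa [Function.comp_def] using (Real.continuous_sqrt.tendsto 0).comp h

/-- Truncation to `s` increases the `ℓ²`-norm of the differences by at most twice the norm of the
part outside `s`. -/
theorem l2Norm_diff_indicator_le (hf : Summable fun i => f i ^ 2) (s : Set ℤ) :
    l2Norm (fun i => s.indicator f i - s.indicator f (i - 1)) ≤
      l2Norm (fun i => f i - f (i - 1)) + 2 * l2Norm (sᶜ.indicator f) := by
  have hc := summable_sq_indicator hf sᶜ
  have h1 := l2_sub_le hc (summable_sq_shift hc (-1))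
  have h2 := (l2_sub_le (l2_sub_le hf (summable_sq_shift hf (-1))).1 h1.1).2
  rw [l2Norm_shift] at h1
  have e : ∀ i, s.indicator f i = f i - sᶜ.indicator f i := fun i => by
    by_cases h : i ∈ s <;> simp [h]
  have e2 : (fun i => s.indicator f i - s.indicator f (i - 1)) = fun i =>
      (f i - f (i + -1)) - (sᶜ.indicator f i - sᶜ.indicator f (i + -1)) := by
    funext i
    rw [e, e (i - 1), ← sub_eq_add_neg]
    ring
  rw [e2]
  simp only [sub_eq_add_neg] at h1 h2 ⊢
  linarith [h1.2]

end L2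

/-! ### Conditional expectations along a two-sided filtration -/

section CondExp

variable {Ω : Type*} {m mΩ : MeasurableSpace Ω} {μ : Measure Ω}

/-- Conditional expectation commutes with a measure preserving map. -/
theorem condExp_comp_measurePreserving [IsProbabilityMeasure μ] (hm : m ≤ mΩ) {g : Ω → Ω}
    (hg : MeasurePreserving g μ μ) {f : Ω → ℝ} (hf : Integrable f μ) :
    μ[f ∘ g | m.comap g] =ᵐ[μ] μ[f | m] ∘ g := by
  have hm' : m.comap g ≤ mΩ :=
    (MeasurableSpace.comap_mono hm).trans hg.measurable.comap_le
  have hmap : ∀ (h : Ω → ℝ), Integrable h μ → ∀ t, MeasurableSet[mΩ] t →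
      ∫ ω in g ⁻¹' t, h (g ω) ∂μ = ∫ ω in t, h ω ∂μ := by
    intro h hh t ht
    have := setIntegral_map (μ := μ) (g := g) (f := h) ht
      (by rw [hg.map_eq]; exact hh.aestronglyMeasurable) hg.aemeasurable
    rw [hg.map_eq] at this
    exact this.symm
  refine (ae_eq_condExp_of_forall_setIntegral_eq hm' (hg.integrable_comp_of_integrable hf)
    (fun s _ _ => (hg.integrable_comp_of_integrable integrable_condExp).integrableOn) ?_ ?_).symm
  · rintro s ⟨t, ht, rfl⟩ -
    exact (hmap _ integrable_condExp t (hm t ht)).trans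
      ((setIntegral_condExp hm hf ht).trans (hmap _ hf t (hm t ht)).symm)
  · exact (stronglyMeasurable_condExp.comp_measurable
      (measurable_iff_comap_le.2 le_rfl)).aestronglyMeasurable

theorem sum_Ioc_int_sub (f : ℤ → ℝ) {a b : ℤ} (hab : a ≤ b) :
    ∑ j ∈ Finset.Ioc a b, (f j - f (j - 1)) = f b - f a := by
  induction b, hab using Int.leInduction with
  | base => simp
  | succ b hab ih =>
    rw [← Finset.insert_Ioc_right_eq_Ioc_add_one hab, Finset.sum_insert (by simp), ih,
      add_sub_cancel_right]
    ring

/-- If the martingale differences `𝔼(ξ|ℱ_j) - 𝔼(ξ|ℱ_{j-1})` of an `ℱ_∞`-measurable `ξ` with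
`𝔼(ξ|ℱ_{-∞}) = 0` are absolutely summable, with integrable sum, then they sum to `ξ`. Lévy's
upward theorem gives the limit at `+∞`. The limit at `-∞` exists by summability, is
`ℱ_{-∞}`-measurable, and by dominated convergence has the same integrals as `ξ` over the sets of
`ℱ_{-∞}`, so it vanishes. -/
theorem hasSum_condExp_sub [IsProbabilityMeasure μ] {ℱ : ℤ → MeasurableSpace Ω}
    (hmono : Monotone ℱ) (hle : ∀ j, ℱ j ≤ mΩ) {ξ : Ω → ℝ} (hξ : Integrable ξ μ)
    (hinf : μ[ξ | ⨅ n : ℕ, ℱ (-(n : ℤ))] =ᵐ[μ] 0) (htop : Measurable[⨆ k, ℱ k] ξ)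
    (hs : ∀ᵐ ω ∂μ, Summable fun j => |(μ[ξ | ℱ j] - μ[ξ | ℱ (j - 1)]) ω|)
    (hint : Integrable (fun ω => ∑' j, |(μ[ξ | ℱ j] - μ[ξ | ℱ (j - 1)]) ω|) μ) :
    ∀ᵐ ω ∂μ, HasSum (fun j => (μ[ξ | ℱ j] - μ[ξ | ℱ (j - 1)]) ω) (ξ ω) := by
  set D : ℤ → Ω → ℝ := fun j => μ[ξ | ℱ j] - μ[ξ | ℱ (j - 1)] with hD
  have htel : ∀ (a b : ℤ) (ω : Ω), a ≤ b →
      ∑ j ∈ Finset.Ioc a b, D j ω = (μ[ξ | ℱ b]) ω - (μ[ξ | ℱ a]) ω := fun a b ω hab =>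
    sum_Ioc_int_sub (fun j => (μ[ξ | ℱ j]) ω) hab
  -- the limit at `+∞`
  let 𝒢 : Filtration ℕ mΩ := ⟨fun n => ℱ n, fun i j hij => hmono (by exact_mod_cast hij),
    fun n => hle n⟩
  have hsup : ⨆ k, ℱ k = ⨆ n, 𝒢 n :=
    le_antisymm (iSup_le fun k => (hmono (Int.self_le_toNat k)).trans
      (le_iSup (fun n : ℕ => 𝒢 n) k.toNat)) (iSup_le fun n => le_iSup ℱ (n : ℤ))
  have hup : ∀ᵐ ω ∂μ, Tendsto (fun n : ℕ => (μ[ξ | ℱ n]) ω) atTop (𝓝 (ξ ω)) := by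
    rw [hsup] at htop
    exact hξ.tendsto_ae_condExp (ℱ := 𝒢) htop.stronglyMeasurable
  -- the limit at `-∞`
  set Z : Ω → ℝ := fun ω => limsup (fun n : ℕ => (μ[ξ | ℱ (-(n : ℤ))]) ω) atTop with hZ
  have hlow : ∀ᵐ ω ∂μ, Tendsto (fun n : ℕ => (μ[ξ | ℱ (-(n : ℤ))]) ω) atTop
      (𝓝 (ξ ω - ∑' j, D j ω)) := by
    filter_upwards [hs, hup] with ω h1 h2
    have h3 := (Summable.of_abs h1).hasSum.comp (Finset.tendsto_Ioc_neg (R := ℤ))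
    refine (h2.sub h3).congr fun n => ?_
    simp only [Function.comp]
    rw [htel _ _ _ (by simp)]
    ring
  have hZeq : ∀ᵐ ω ∂μ, Z ω = ξ ω - ∑' j, D j ω := hlow.mono fun ω h => h.limsup_eq
  have hZlim : ∀ᵐ ω ∂μ, Tendsto (fun n : ℕ => (μ[ξ | ℱ (-(n : ℤ))]) ω) atTop (𝓝 (Z ω)) := by
    filter_upwards [hlow, hZeq] with ω h1 h2
    rwa [h2]
  have hZm : Measurable[⨅ n : ℕ, ℱ (-(n : ℤ))] Z := by
    intro t ht
    rw [MeasurableSpace.measurableSet_iInf]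
    intro k
    have : Measurable[ℱ (-(k : ℤ))] Z := by
      have e : Z = fun ω => limsup (fun n : ℕ => (μ[ξ | ℱ (-((n + k : ℕ) : ℤ))]) ω) atTop :=
        funext fun ω => (limsup_nat_add (fun n : ℕ => (μ[ξ | ℱ (-(n : ℤ))]) ω) k).symm
      rw [e]
      exact Measurable.limsup fun n => (stronglyMeasurable_condExp.mono
        (hmono (by push_cast; omega))).measurable
    exact this ht
  have hbd : ∀ n : ℕ, ∀ᵐ ω ∂μ, ‖(μ[ξ | ℱ (-(n : ℤ))]) ω‖ ≤
      |(μ[ξ | ℱ 0]) ω| + ∑' j, |D j ω| := by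
    intro n
    filter_upwards [hs] with ω h1
    have e : (μ[ξ | ℱ (-(n : ℤ))]) ω =
        (μ[ξ | ℱ 0]) ω - ∑ j ∈ Finset.Ioc (-(n : ℤ)) 0, D j ω := by
      rw [htel _ _ _ (by simp)]
      ring
    rw [e, Real.norm_eq_abs]
    refine (abs_sub _ _).trans ?_
    gcongr
    exact (Finset.abs_sum_le_sum_abs _ _).trans (h1.sum_le_tsum _ fun j _ => abs_nonneg _)
  have hbi : Integrable (fun ω => |(μ[ξ | ℱ 0]) ω| + ∑' j, |D j ω|) μ :=
    integrable_condExp.abs.add hint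
  have hinfle : (⨅ n : ℕ, ℱ (-(n : ℤ))) ≤ mΩ := (iInf_le _ 0).trans (hle _)
  have hZint : Integrable Z μ := by
    refine hbi.mono' (hZm.mono hinfle le_rfl).aestronglyMeasurable ?_
    filter_upwards [hZlim, ae_all_iff.2 hbd] with ω h1 h2
    exact le_of_tendsto' h1.norm h2
  have hZ0 : Z =ᵐ[μ] 0 := by
    refine (ae_eq_condExp_of_forall_setIntegral_eq hinfle hξ (fun s _ _ => hZint.integrableOn)
      (fun s hs' _ => ?_) hZm.stronglyMeasurable.aestronglyMeasurable).trans hinf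
    have hlim := tendsto_integral_of_dominated_convergence (μ := μ.restrict s)
      (F := fun n : ℕ => μ[ξ | ℱ (-(n : ℤ))]) (f := Z) _
      (fun n => integrable_condExp.aestronglyMeasurable.restrict) hbi.integrableOn
      (fun n => ae_restrict_of_ae (hbd n)) (ae_restrict_of_ae hZlim)
    refine tendsto_nhds_unique hlim (tendsto_const_nhds.congr fun n => ?_)
    exact (setIntegral_condExp (hle _) hξ (iInf_le (fun n : ℕ => ℱ (-(n : ℤ))) n s hs')).symm
  filter_upwards [hs, hZeq, hZ0] with ω h1 h2 h3
  have : ξ ω = ∑' j, D j ω := by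
    rw [h3] at h2
    simpa using (sub_eq_zero.1 h2.symm)
  rw [this]
  exact (Summable.of_abs h1).hasSum

end CondExp

/-! ### Stationary sequences -/

section Stationary

variable {Ω : Type*} {F₀ mΩ : MeasurableSpace Ω} {μ : Measure Ω} {T : Ω ≃ᵐ Ω}

theorem shiftPow_zero : shiftPow T 0 = id := by
  simp only [shiftPow, zpow_zero]; rfl

theorem shiftPow_add (i j : ℤ) : shiftPow T (i + j) = shiftPow T i ∘ shiftPow T j := by
  simp only [shiftPow, zpow_add]; rfl

theorem shiftPow_one : shiftPow T 1 = T := by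
  simp only [shiftPow, zpow_one]; rfl

theorem shiftPow_neg_one : shiftPow T (-1) = T.symm := by
  simp only [shiftPow, zpow_neg_one]; rfl

theorem measurePreserving_shiftPow (hT : MeasurePreserving T μ μ) (i : ℤ) :
    MeasurePreserving (shiftPow T i) μ μ := by
  induction i with
  | zero => rw [shiftPow_zero]; exact MeasurePreserving.id μ
  | succ i ih => rw [shiftPow_add, shiftPow_one]; exact ih.comp hT
  | pred i ih =>
    rw [sub_eq_add_neg, shiftPow_add, shiftPow_neg_one]
    exact ih.comp (hT.symm T)

theorem stationarySeq_zero (ξ₀ : Ω → ℝ) : stationarySeq T ξ₀ 0 = ξ₀ := by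
  rw [stationarySeq, shiftPow_zero]; rfl

theorem stationarySeq_add (ξ₀ : Ω → ℝ) (i j : ℤ) :
    stationarySeq T ξ₀ (i + j) = stationarySeq T ξ₀ i ∘ shiftPow T j := by
  rw [stationarySeq, shiftPow_add]; rfl

theorem statFiltration_add (i j : ℤ) :
    statFiltration T F₀ (i + j) = (statFiltration T F₀ i).comap (shiftPow T j) := by
  rw [statFiltration, statFiltration, MeasurableSpace.comap_comp, shiftPow_add]

theorem statFiltration_mono (hF : F₀ ≤ F₀.comap T) : Monotone (statFiltration T F₀) := by
  refine monotone_int_of_le_succ fun i => ?_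
  rw [add_comm, statFiltration_add, statFiltration, statFiltration, shiftPow_one]
  exact MeasurableSpace.comap_mono hF

theorem statFiltration_le (hT : MeasurePreserving T μ μ) (hF₀ : F₀ ≤ mΩ) (i : ℤ) :
    statFiltration T F₀ i ≤ mΩ :=
  (MeasurableSpace.comap_mono hF₀).trans (measurePreserving_shiftPow hT i).measurable.comap_le

theorem stronglyMeasurable_proj (hF : F₀ ≤ F₀.comap T) (j : ℤ) (Y : Ω → ℝ) :
    StronglyMeasurable[statFiltration T F₀ j] (proj μ T F₀ j Y) :=
  stronglyMeasurable_condExp.sub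
    (stronglyMeasurable_condExp.mono (statFiltration_mono hF (by omega)))

theorem integrable_proj (j : ℤ) (Y : Ω → ℝ) : Integrable (proj μ T F₀ j Y) μ :=
  integrable_condExp.sub integrable_condExp

theorem condExp_proj [IsProbabilityMeasure μ] (hT : MeasurePreserving T μ μ) (hF₀ : F₀ ≤ mΩ)
    (hF : F₀ ≤ F₀.comap T) (j : ℤ) (Y : Ω → ℝ) :
    μ[proj μ T F₀ j Y | statFiltration T F₀ (j - 1)] =ᵐ[μ] 0 := by
  have h1 : μ[μ[Y | statFiltration T F₀ j] | statFiltration T F₀ (j - 1)] =ᵐ[μ]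
      μ[Y | statFiltration T F₀ (j - 1)] :=
    condExp_condExp_of_le (statFiltration_mono hF (by omega)) (statFiltration_le hT hF₀ j)
  have h2 : μ[μ[Y | statFiltration T F₀ (j - 1)] | statFiltration T F₀ (j - 1)] =
      μ[Y | statFiltration T F₀ (j - 1)] :=
    condExp_of_stronglyMeasurable (statFiltration_le hT hF₀ _) stronglyMeasurable_condExp
      integrable_condExp
  filter_upwards [condExp_sub (μ := μ) (integrable_condExp (f := Y) (m := statFiltration T F₀ j))
    (integrable_condExp (f := Y) (m := statFiltration T F₀ (j - 1)))
    (statFiltration T F₀ (j - 1)), h1] with ω h3 h4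
  refine h3.trans ?_
  simp [h2, h4]

/-- The projections are equivariant under the shift. -/
theorem proj_comp_shiftPow [IsProbabilityMeasure μ] (hT : MeasurePreserving T μ μ) (hF₀ : F₀ ≤ mΩ)
    {Y : Ω → ℝ} (hY : Integrable Y μ) (i j : ℤ) :
    proj μ T F₀ (i + j) (Y ∘ shiftPow T j) =ᵐ[μ] proj μ T F₀ i Y ∘ shiftPow T j := by
  have hg := measurePreserving_shiftPow hT j
  have h1 := condExp_comp_measurePreserving (statFiltration_le hT hF₀ i) hg hY
  have h2 := condExp_comp_measurePreserving (statFiltration_le hT hF₀ (i - 1)) hg hY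
  rw [← statFiltration_add] at h1 h2
  rw [show i - 1 + j = i + j - 1 by ring] at h2
  exact h1.sub h2

end Stationary

/-! ### Summation by diagonals -/

section Diagonals

variable {Ω : Type*} {mΩ : MeasurableSpace Ω} {μ : Measure Ω} {α : ℝ} {Ψ : ℝ → ℝ}

/-- Summation by parts for a shift by `k`: the differences move from `y` to the truncated
coefficients. -/
theorem sum_mul_shift_sub (s : Finset ℤ) (c y : ℤ → ℝ) (k : ℤ) :
    ∑ i ∈ s, c i * (y (i - k) - y i) =
      ∑ j ∈ s ∪ s.image (· - k),
        ((s : Set ℤ).indicator c (j + k) - (s : Set ℤ).indicator c j) * y j := by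
  simp only [sub_mul, mul_sub, Finset.sum_sub_distrib]
  congr 1
  · rw [← Finset.sum_subset (Finset.subset_union_right (s₁ := s) (s₂ := s.image (· - k)))]
    · rw [Finset.sum_image fun a _ b _ h => sub_left_injective h]
      refine Finset.sum_congr rfl fun i hi => ?_
      simp [hi]
    · intro j _ hj
      have : j + k ∉ s := fun h => hj (Finset.mem_image.2 ⟨j + k, h, by ring⟩)
      simp [this]
  · rw [← Finset.sum_subset (Finset.subset_union_left (s₁ := s) (s₂ := s.image (· - k)))]
    · refine Finset.sum_congr rfl fun i hi => ?_
      simp [hi]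
    · intro j _ hj
      simp [hj]

theorem summable_sq_indicator_finset (s : Finset ℤ) (c : ℤ → ℝ) :
    Summable fun i => (s : Set ℤ).indicator c i ^ 2 :=
  summable_of_ne_finset_zero (s := s) fun i hi => by simp [hi]

/-- The bound for finite sums. Summing along the diagonals `k`, the sum of `c_i (ξ_i - d_i)` is
`∑_k ∑_j (c_{j+k} - c_j) y_{k,j}`. The coefficients of the `k`-th diagonal have `ℓ²`-norm at most
twice that of `c`, which serves for `m ≤ |k|`, and at most `|k|` times that of the consecutive
differences of `c`, which serves for `|k| < m`. -/
theorem orliczNorm_sum_mul_sub_le (hΨ : ClassA α Ψ) (hconv : ConvexOn ℝ (Ici 0) Ψ)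
    {y : ℤ → ℤ → Ω → ℝ} {ξ d : ℤ → Ω → ℝ} {θ : ℤ → ℝ≥0∞} {C : ℝ} (hC : 0 ≤ C)
    (hy : ∀ k j, AEMeasurable (y k j) μ)
    (hξ : ∀ i, ∀ᵐ ω ∂μ, HasSum (fun k => y k (i - k) ω) (ξ i ω))
    (hd : ∀ i, ∀ᵐ ω ∂μ, HasSum (fun k => y k i ω) (d i ω))
    (hbound : ∀ (k : ℤ) (a : ℤ → ℝ) (t : Finset ℤ),
      orliczNorm Ψ μ (fun ω => ∑ j ∈ t, a j * y k j ω) ≤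
        ENNReal.ofReal (C * √(∑ j ∈ t, a j ^ 2)) * θ k)
    (c : ℤ → ℝ) (s : Finset ℤ) (m : ℕ) :
    orliczNorm Ψ μ (fun ω => ∑ i ∈ s, c i * (ξ i ω - d i ω)) ≤
      ENNReal.ofReal (2 * C * l2Norm ((s : Set ℤ).indicator c)) *
          ∑' k : {k : ℤ // (m : ℤ) ≤ |k|}, θ k +
        ENNReal.ofReal (C * m * l2Norm fun i =>
            (s : Set ℤ).indicator c i - (s : Set ℤ).indicator c (i - 1)) * ∑' k, θ k := by
  set f : ℤ → ℝ := (s : Set ℤ).indicator c with hf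
  have hfs : Summable fun i => f i ^ 2 := summable_sq_indicator_finset s c
  set Δ : ℝ := l2Norm fun i => f i - f (i - 1) with hΔ
  have hΔ0 : 0 ≤ Δ := l2Norm_nonneg
  have hm : ∀ k, AEMeasurable (fun ω => ∑ i ∈ s, c i * (y k (i - k) ω - y k i ω)) μ := fun k =>
    Finset.aemeasurable_fun_sum s fun i _ => ((hy _ _).sub (hy _ _)).const_mul _
  have hsum : ∀ᵐ ω ∂μ, HasSum (fun k => ∑ i ∈ s, c i * (y k (i - k) ω - y k i ω))
      (∑ i ∈ s, c i * (ξ i ω - d i ω)) := by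
    filter_upwards [ae_all_iff.2 hξ, ae_all_iff.2 hd] with ω h1 h2
    exact hasSum_sum fun i _ => ((h1 i).sub (h2 i)).mul_left (c i)
  have hdiag : ∀ k, orliczNorm Ψ μ (fun ω => ∑ i ∈ s, c i * (y k (i - k) ω - y k i ω)) ≤
      ENNReal.ofReal (C * l2Norm fun i => f (i + k) - f i) * θ k := by
    intro k
    have e := funext fun ω => sum_mul_shift_sub s c (fun j => y k j ω) k
    rw [e]
    refine (hbound k _ _).trans ?_
    gcongr
    exact Real.sqrt_le_sqrt ((l2_sub_le (summable_sq_shift hfs k) hfs).1.sum_le_tsum _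
      fun j _ => sq_nonneg _)
  have hterm : ∀ k, ENNReal.ofReal (C * l2Norm fun i => f (i + k) - f i) * θ k ≤
      ENNReal.ofReal (2 * C * l2Norm f) * {k : ℤ | (m : ℤ) ≤ |k|}.indicator θ k +
        ENNReal.ofReal (C * m * Δ) * θ k := by
    intro k
    by_cases hk : (m : ℤ) ≤ |k|
    · refine le_add_right ?_
      rw [indicator_of_mem (by exact hk)]
      gcongr ENNReal.ofReal ?_ * _
      have := mul_le_mul_of_nonneg_left (l2Norm_shift_sub_le_two hfs k) hC
      linarith
    · refine le_add_left ?_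
      gcongr ENNReal.ofReal ?_ * _
      have hkm : |(k : ℝ)| ≤ m := by exact_mod_cast (not_le.1 hk).le
      calc C * l2Norm (fun i => f (i + k) - f i) ≤ C * (|(k : ℝ)| * Δ) := by
            gcongr
            exact l2Norm_shift_sub_le hfs k
        _ ≤ C * (m * Δ) := by gcongr
        _ = C * m * Δ := by ring
  calc orliczNorm Ψ μ (fun ω => ∑ i ∈ s, c i * (ξ i ω - d i ω))
      ≤ ∑' k, orliczNorm Ψ μ (fun ω => ∑ i ∈ s, c i * (y k (i - k) ω - y k i ω)) :=
        orliczNorm_le_tsum hΨ hconv hm hsum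
    _ ≤ ∑' k, (ENNReal.ofReal (2 * C * l2Norm f) * {k : ℤ | (m : ℤ) ≤ |k|}.indicator θ k +
        ENNReal.ofReal (C * m * Δ) * θ k) :=
        ENNReal.tsum_le_tsum fun k => (hdiag k).trans (hterm k)
    _ = _ := by
        rw [ENNReal.tsum_add, ENNReal.tsum_mul_left, ENNReal.tsum_mul_left, ← tsum_subtype]
        rfl

end Diagonals

/-! ### The martingale approximation -/

section Approximation

variable {Ω : Type*} {F₀ mΩ : MeasurableSpace Ω} {μ : Measure Ω} {α : ℝ} {Ψ : ℝ → ℝ}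
  {T : Ω ≃ᵐ Ω} {ξ₀ : Ω → ℝ}

theorem integrable_stationarySeq (hT : MeasurePreserving T μ μ) (hξ : Integrable ξ₀ μ) (i : ℤ) :
    Integrable (stationarySeq T ξ₀ i) μ :=
  (measurePreserving_shiftPow hT i).integrable_comp_of_integrable hξ

theorem aemeasurable_proj (j : ℤ) (Y : Ω → ℝ) : AEMeasurable (proj μ T F₀ j Y) μ :=
  (integrable_proj j Y).aemeasurable

/-- By stationarity, the norm of `P_j(ξ_l)` depends on `l - j` only. -/
theorem orliczNorm_proj_stationarySeq [IsProbabilityMeasure μ] (hT : MeasurePreserving T μ μ)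
    (hF₀ : F₀ ≤ mΩ) (hΨ : ClassA α Ψ) (hξ : Integrable ξ₀ μ) (j l : ℤ) :
    orliczNorm Ψ μ (proj μ T F₀ j (stationarySeq T ξ₀ l)) =
      orliczNorm Ψ μ (proj μ T F₀ 0 (stationarySeq T ξ₀ (l - j))) := by
  have h := proj_comp_shiftPow hT hF₀ (integrable_stationarySeq hT hξ (l - j)) 0 j
  rw [← stationarySeq_add, sub_add_cancel, zero_add] at h
  rw [orliczNorm_congr hΨ h, orliczNorm_comp_measurePreserving hΨ (aemeasurable_proj _ _)
    (measurePreserving_shiftPow hT j)]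

theorem tsum_orliczNorm_proj_lt_top [IsProbabilityMeasure μ] (hT : MeasurePreserving T μ μ)
    (hF₀ : F₀ ≤ mΩ) (hΨ : ClassA α Ψ) (hξ : Integrable ξ₀ μ)
    (hΘ : ∑' j : ℤ, orliczNorm Ψ μ (proj μ T F₀ 0 (stationarySeq T ξ₀ j)) < ∞) (j : ℤ) :
    ∑' l, orliczNorm Ψ μ (proj μ T F₀ j (stationarySeq T ξ₀ l)) < ∞ := by
  simp only [orliczNorm_proj_stationarySeq hT hF₀ hΨ hξ j]
  exact ((Equiv.subRight j).tsum_eq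
    fun k => orliczNorm Ψ μ (proj μ T F₀ 0 (stationarySeq T ξ₀ k))).trans_lt hΘ

theorem hasSum_martDiff [IsProbabilityMeasure μ] (hT : MeasurePreserving T μ μ)
    (hF₀ : F₀ ≤ mΩ) (hΨ : ClassA α Ψ) (hconv : ConvexOn ℝ (Ici 0) Ψ)
    (hne : ∃ x : ℝ, 0 ≤ x ∧ Ψ x ≠ 0) (hξ : Integrable ξ₀ μ)
    (hΘ : ∑' j : ℤ, orliczNorm Ψ μ (proj μ T F₀ 0 (stationarySeq T ξ₀ j)) < ∞) (j : ℤ) :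
    ∀ᵐ ω ∂μ, HasSum (fun l => proj μ T F₀ j (stationarySeq T ξ₀ l) ω) (martDiff μ T F₀ ξ₀ j ω) :=
  (integrable_tsum_abs hΨ hconv hne (fun _ => aemeasurable_proj j _)
    (tsum_orliczNorm_proj_lt_top hT hF₀ hΨ hξ hΘ j)).1.mono
      fun _ h => (Summable.of_abs h).hasSum

theorem orliczHasSum_martDiff [IsProbabilityMeasure μ] (hT : MeasurePreserving T μ μ)
    (hF₀ : F₀ ≤ mΩ) (hΨ : ClassA α Ψ) (hconv : ConvexOn ℝ (Ici 0) Ψ)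
    (hne : ∃ x : ℝ, 0 ≤ x ∧ Ψ x ≠ 0) (hξ : Integrable ξ₀ μ)
    (hΘ : ∑' j : ℤ, orliczNorm Ψ μ (proj μ T F₀ 0 (stationarySeq T ξ₀ j)) < ∞) (j : ℤ) :
    OrliczHasSum Ψ μ (fun l : ℤ => proj μ T F₀ j (stationarySeq T ξ₀ l))
      (martDiff μ T F₀ ξ₀ j) :=
  orliczHasSum_tsum hΨ hconv (fun _ => aemeasurable_proj j _)
    (tsum_orliczNorm_proj_lt_top hT hF₀ hΨ hξ hΘ j)
    ((hasSum_martDiff hT hF₀ hΨ hconv hne hξ hΘ j).mono fun _ h => h.summable)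

/-- A regular variable is the sum of its projections. -/
theorem hasSum_proj [IsProbabilityMeasure μ] (hT : MeasurePreserving T μ μ)
    (hF₀ : F₀ ≤ mΩ) (hF : F₀ ≤ F₀.comap T) (hΨ : ClassA α Ψ) (hconv : ConvexOn ℝ (Ici 0) Ψ)
    (hne : ∃ x : ℝ, 0 ≤ x ∧ Ψ x ≠ 0) (hξ : Integrable ξ₀ μ) (hreg : IsRegularVar μ T F₀ ξ₀)
    (hΘ : ∑' j : ℤ, orliczNorm Ψ μ (proj μ T F₀ 0 (stationarySeq T ξ₀ j)) < ∞) :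
    ∀ᵐ ω ∂μ, HasSum (fun j => proj μ T F₀ j ξ₀ ω) (ξ₀ ω) := by
  have hfin : ∑' j, orliczNorm Ψ μ (proj μ T F₀ j ξ₀) < ∞ := by
    have e : ∀ j, orliczNorm Ψ μ (proj μ T F₀ j ξ₀) =
        orliczNorm Ψ μ (proj μ T F₀ 0 (stationarySeq T ξ₀ (-j))) := fun j => by
      rw [← zero_sub, ← orliczNorm_proj_stationarySeq hT hF₀ hΨ hξ, stationarySeq_zero]
    simp only [e]
    exact ((Equiv.neg ℤ).tsum_eq
      fun k => orliczNorm Ψ μ (proj μ T F₀ 0 (stationarySeq T ξ₀ k))).trans_lt hΘ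
  obtain ⟨hs, hi⟩ := integrable_tsum_abs hΨ hconv hne (fun j => aemeasurable_proj j ξ₀) hfin
  exact hasSum_condExp_sub (statFiltration_mono hF) (statFiltration_le hT hF₀) hξ hreg.1 hreg.2
    hs hi

/-- The expansion of `ξ_i` into its projections, from that of `ξ_0` by stationarity. -/
theorem hasSum_proj_stationarySeq [IsProbabilityMeasure μ] (hT : MeasurePreserving T μ μ)
    (hF₀ : F₀ ≤ mΩ) (hF : F₀ ≤ F₀.comap T) (hΨ : ClassA α Ψ) (hconv : ConvexOn ℝ (Ici 0) Ψ)
    (hne : ∃ x : ℝ, 0 ≤ x ∧ Ψ x ≠ 0) (hξ : Integrable ξ₀ μ) (hreg : IsRegularVar μ T F₀ ξ₀)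
    (hΘ : ∑' j : ℤ, orliczNorm Ψ μ (proj μ T F₀ 0 (stationarySeq T ξ₀ j)) < ∞) (i : ℤ) :
    ∀ᵐ ω ∂μ, HasSum (fun k => proj μ T F₀ (i - k) (stationarySeq T ξ₀ i) ω)
      (stationarySeq T ξ₀ i ω) := by
  have h1 := (measurePreserving_shiftPow hT i).quasiMeasurePreserving.ae
    (hasSum_proj hT hF₀ hF hΨ hconv hne hξ hreg hΘ)
  have h2 : ∀ᵐ ω ∂μ, ∀ k, proj μ T F₀ (i - k) (stationarySeq T ξ₀ i) ω =
      proj μ T F₀ (-k) ξ₀ (shiftPow T i ω) := by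
    refine ae_all_iff.2 fun k => ?_
    have h := proj_comp_shiftPow hT hF₀ hξ (-k) i
    rw [neg_add_eq_sub] at h
    exact h
  filter_upwards [h1, h2] with ω h3 h4
  simp only [h4]
  exact (Equiv.neg ℤ).hasSum_iff (f := fun j => proj μ T F₀ j ξ₀ (shiftPow T i ω)) |>.2 h3

/-- The bound for sums over a finite set of times. -/
theorem orliczNorm_sum_sub_martDiff_le [IsProbabilityMeasure μ] (hα : 0 < α)
    (hT : MeasurePreserving T μ μ) (hF₀ : F₀ ≤ mΩ) (hF : F₀ ≤ F₀.comap T) (hΨ : ClassA α Ψ)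
    (hconv : ConvexOn ℝ (Ici 0) Ψ) (hsq : ConvexOn ℝ (Ici 0) fun x => Ψ √x)
    (hne : ∃ x : ℝ, 0 ≤ x ∧ Ψ x ≠ 0) (hξ : Integrable ξ₀ μ) (hreg : IsRegularVar μ T F₀ ξ₀)
    (hΘ : ∑' j : ℤ, orliczNorm Ψ μ (proj μ T F₀ 0 (stationarySeq T ξ₀ j)) < ∞)
    (c : ℤ → ℝ) (s : Finset ℤ) (m : ℕ) :
    orliczNorm Ψ μ
        (fun ω => ∑ i ∈ s, c i * (stationarySeq T ξ₀ i ω - martDiff μ T F₀ ξ₀ i ω)) ≤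
      ENNReal.ofReal (2 * martConst α * l2Norm ((s : Set ℤ).indicator c)) *
          ∑' k : {k : ℤ // (m : ℤ) ≤ |k|},
            orliczNorm Ψ μ (proj μ T F₀ 0 (stationarySeq T ξ₀ k)) +
        ENNReal.ofReal (martConst α * m * l2Norm fun i =>
            (s : Set ℤ).indicator c i - (s : Set ℤ).indicator c (i - 1)) *
          ∑' k, orliczNorm Ψ μ (proj μ T F₀ 0 (stationarySeq T ξ₀ k)) := by
  -- `P_j(ξ_{j+k})` are the martingale differences on the `k`-th diagonal
  refine orliczNorm_sum_mul_sub_le hΨ hconv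
    (y := fun k j => proj μ T F₀ j (stationarySeq T ξ₀ (j + k)))
    (θ := fun k => orliczNorm Ψ μ (proj μ T F₀ 0 (stationarySeq T ξ₀ k)))
    martConst_pos.le (fun k j => aemeasurable_proj j _) (fun i => ?_) (fun i => ?_)
    (fun k a t => ?_) c s m
  · simp only [sub_add_cancel]
    exact hasSum_proj_stationarySeq hT hF₀ hF hΨ hconv hne hξ hreg hΘ i
  · filter_upwards [hasSum_martDiff hT hF₀ hΨ hconv hne hξ hΘ i] with ω h
    exact (Equiv.addLeft i).hasSum_iff
      (f := fun l => proj μ T F₀ i (stationarySeq T ξ₀ l) ω) |>.2 h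
  · exact orliczNorm_sum_martingale_le hα hΨ hconv hsq (statFiltration_mono hF)
      (statFiltration_le hT hF₀) (fun j => stronglyMeasurable_proj hF j _)
      (fun j => integrable_proj j _) (fun j => condExp_proj hT hF₀ hF j _)
      (fun j => by rw [orliczNorm_proj_stationarySeq hT hF₀ hΨ hξ, add_sub_cancel_left]) a t

/-- Convergence of a series whose finite partial sums obey the bound of
`orliczNorm_sum_mul_sub_le`. -/
theorem exists_orliczHasSum_of_l2_bound [IsProbabilityMeasure μ] (hΨ : ClassA α Ψ)
    (hconv : ConvexOn ℝ (Ici 0) Ψ) (hne : ∃ x : ℝ, 0 ≤ x ∧ Ψ x ≠ 0) {X : ℤ → Ω → ℝ}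
    (hX : ∀ i, AEMeasurable (X i) μ) {c : ℤ → ℝ} (hc : Summable fun i => c i ^ 2) {B : ℝ}
    (hB : 0 ≤ B) {Θ : ℝ≥0∞} (hΘ : Θ ≠ ∞)
    (hle : ∀ s : Finset ℤ, orliczNorm Ψ μ (fun ω => ∑ i ∈ s, X i ω) ≤
      ENNReal.ofReal (B * l2Norm ((s : Set ℤ).indicator c)) * Θ) :
    ∃ S, OrliczHasSum Ψ μ X S := by
  refine exists_orliczHasSum hΨ hconv hne hX (fun i => ?_) fun ε hε => ?_
  · have := hle {i}
    simp only [Finset.sum_singleton] at this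
    exact this.trans_lt (ENNReal.mul_lt_top ENNReal.ofReal_lt_top hΘ.lt_top)
  · have hlim : Tendsto (fun s : Finset ℤ =>
        ENNReal.ofReal (B * l2Norm ((s : Set ℤ)ᶜ.indicator c)) * Θ) atTop (𝓝 0) := by
      have := ENNReal.Tendsto.mul_const
        ((ENNReal.continuous_ofReal.tendsto _).comp
          ((tendsto_l2Norm_indicator_compl (f := c)).const_mul B)) (Or.inr hΘ)
      simpa using this
    obtain ⟨s, hs⟩ := (hlim.eventually_le_const (ENNReal.ofReal_pos.2 hε)).exists
    refine ⟨s, fun t ht => (hle t).trans (le_trans ?_ hs)⟩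
    gcongr
    have e : (t : Set ℤ).indicator c = (t : Set ℤ).indicator ((s : Set ℤ)ᶜ.indicator c) := by
      rw [indicator_indicator, inter_eq_left.2]
      exact fun i hi hi' => Finset.disjoint_left.1 ht hi hi'
    rw [e]
    exact l2Norm_indicator_le (summable_sq_indicator hc _) _

/-- Passage to the limit in the bound of `orliczNorm_sum_mul_sub_le`. -/
theorem OrliczHasSum.norm_le_of_l2_bound (hΨ : ClassA α Ψ) (hconv : ConvexOn ℝ (Ici 0) Ψ)
    {X : ℤ → Ω → ℝ} {S : Ω → ℝ} (hS : OrliczHasSum Ψ μ X S)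
    (hX : ∀ i, AEMeasurable (X i) μ) {c : ℤ → ℝ} (hc : Summable fun i => c i ^ 2) {B B' : ℝ}
    (hB : 0 ≤ B) (hB' : 0 ≤ B') {A Θ : ℝ≥0∞} (hΘ : Θ ≠ ∞)
    (hle : ∀ s : Finset ℤ, orliczNorm Ψ μ (fun ω => ∑ i ∈ s, X i ω) ≤
      ENNReal.ofReal (B * l2Norm ((s : Set ℤ).indicator c)) * A +
        ENNReal.ofReal (B' * l2Norm fun i =>
          (s : Set ℤ).indicator c i - (s : Set ℤ).indicator c (i - 1)) * Θ) :
    orliczNorm Ψ μ S ≤ ENNReal.ofReal (B * l2Norm c) * A +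
      ENNReal.ofReal (B' * l2Norm fun i => c i - c (i - 1)) * Θ := by
  set D : ℝ := l2Norm fun i => c i - c (i - 1) with hD
  have hbd : ∀ s : Finset ℤ, orliczNorm Ψ μ S ≤
      orliczNorm Ψ μ (fun ω => (∑ i ∈ s, X i ω) - S ω) +
      (ENNReal.ofReal (B * l2Norm c) * A + ENNReal.ofReal
        (B' * (D + 2 * l2Norm ((s : Set ℤ)ᶜ.indicator c))) * Θ) := by
    intro s
    have hDm : AEMeasurable (fun ω => ∑ i ∈ s, X i ω) μ :=
      Finset.aemeasurable_fun_sum s fun i _ => hX i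
    have h1 := orliczNorm_add_le hΨ hconv (hS.1.1.sub hDm) hDm
    simp only [Pi.sub_apply, sub_add_cancel] at h1
    refine h1.trans (add_le_add (orliczNorm_sub_comm hΨ _ _).le ((hle s).trans ?_))
    gcongr
    · exact l2Norm_indicator_le hc _
    · exact l2Norm_diff_indicator_le hc _
  have herr : Tendsto (fun s : Finset ℤ => ENNReal.ofReal
      (B' * (D + 2 * l2Norm ((s : Set ℤ)ᶜ.indicator c))) * Θ) atTop
      (𝓝 (ENNReal.ofReal (B' * (D + 2 * 0)) * Θ)) :=
    ENNReal.Tendsto.mul_const ((ENNReal.continuous_ofReal.tendsto _).comp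
      (((tendsto_l2Norm_indicator_compl.const_mul 2).const_add D).const_mul B')) (Or.inr hΘ)
  have hlim := hS.2.add (herr.const_add (ENNReal.ofReal (B * l2Norm c) * A))
  simpa using ge_of_tendsto' hlim hbd

/-- The convergence and the bound for one square-summable sequence of weights. -/
theorem sum_sub_martDiff_bound [IsProbabilityMeasure μ] (hα : 0 < α)
    (hT : MeasurePreserving T μ μ) (hF₀ : F₀ ≤ mΩ) (hF : F₀ ≤ F₀.comap T) (hΨ : ClassA α Ψ)
    (hconv : ConvexOn ℝ (Ici 0) Ψ) (hsq : ConvexOn ℝ (Ici 0) fun x => Ψ √x)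
    (hne : ∃ x : ℝ, 0 ≤ x ∧ Ψ x ≠ 0) (hξ : Integrable ξ₀ μ) (hreg : IsRegularVar μ T F₀ ξ₀)
    (hΘ : ∑' j : ℤ, orliczNorm Ψ μ (proj μ T F₀ 0 (stationarySeq T ξ₀ j)) < ∞)
    {c : ℤ → ℝ} (hc : Summable fun i => c i ^ 2) :
    (∃ S : Ω → ℝ, OrliczHasSum Ψ μ
      (fun (i : ℤ) ω => c i * (stationarySeq T ξ₀ i ω - martDiff μ T F₀ ξ₀ i ω)) S) ∧
    ∀ S : Ω → ℝ, OrliczHasSum Ψ μ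
      (fun (i : ℤ) ω => c i * (stationarySeq T ξ₀ i ω - martDiff μ T F₀ ξ₀ i ω)) S →
      ∀ m : ℕ, orliczNorm Ψ μ S ≤
        ENNReal.ofReal (2 * martConst α * l2Norm c) *
            ∑' k : {k : ℤ // (m : ℤ) ≤ |k|},
              orliczNorm Ψ μ (proj μ T F₀ 0 (stationarySeq T ξ₀ k)) +
          ENNReal.ofReal (martConst α * m * l2Norm fun i => c i - c (i - 1)) *
            ∑' k, orliczNorm Ψ μ (proj μ T F₀ 0 (stationarySeq T ξ₀ k)) := by
  have hC : 0 < martConst α := martConst_pos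
  have hfinite := orliczNorm_sum_sub_martDiff_le hα hT hF₀ hF hΨ hconv hsq hne hξ hreg hΘ c
  have hX : ∀ i, AEMeasurable
      (fun ω => c i * (stationarySeq T ξ₀ i ω - martDiff μ T F₀ ξ₀ i ω)) μ := fun i =>
    ((integrable_stationarySeq hT hξ i).aemeasurable.sub
      (orliczHasSum_martDiff hT hF₀ hΨ hconv hne hξ hΘ i).1.1).const_mul _
  refine ⟨exists_orliczHasSum_of_l2_bound hΨ hconv hne hX hc (B := 2 * martConst α)
    (by positivity) hΘ.ne fun s => (hfinite s 0).trans ?_, fun S hS m =>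
    hS.norm_le_of_l2_bound hΨ hconv hX hc (by positivity) (by positivity) hΘ.ne
      fun s => hfinite s m⟩
  simp only [Nat.cast_zero, mul_zero, zero_mul, ENNReal.ofReal_zero, add_zero]
  gcongr
  exact ENNReal.tsum_comp_le_tsum_of_injective Subtype.val_injective
    fun k => orliczNorm Ψ μ (proj μ T F₀ 0 (stationarySeq T ξ₀ k))

end Approximation

theorem mainTheorem8 (α : ℝ) (hα : 0 < α) :
    ∃ C : ℝ, 0 < C ∧
      ∀ {Ω : Type*} [mΩ : MeasurableSpace Ω] (μ : Measure Ω) [IsProbabilityMeasure μ]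
        (T : Ω ≃ᵐ Ω) (_ : MeasurePreserving T μ μ)
        (F₀ : MeasurableSpace Ω) (_ : F₀ ≤ mΩ) (_ : F₀ ≤ F₀.comap T)
        (Ψ : ℝ → ℝ) (_ : ClassA α Ψ) (_ : ConvexOn ℝ (Ici 0) Ψ)
        (_ : ConvexOn ℝ (Ici 0) (fun x => Ψ (Real.sqrt x)))
        (_ : ∃ x : ℝ, 0 ≤ x ∧ Ψ x ≠ 0)
        (ξ₀ : Ω → ℝ) (_ : IsRegularVar μ T F₀ ξ₀) (_ : MemOrlicz Ψ μ ξ₀)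
        (_ : ∑' j : ℤ, orliczNorm Ψ μ (proj μ T F₀ 0 (stationarySeq T ξ₀ j)) < ∞)
        (c : ℕ → ℤ → ℝ) (_ : ∀ n : ℕ, 0 < n → Summable (fun i : ℤ => c n i ^ 2)),
        -- the series defining each `d_j` converges in `L_Ψ`
        (∀ j : ℤ, OrliczHasSum Ψ μ (fun l : ℤ => proj μ T F₀ j (stationarySeq T ξ₀ l))
          (martDiff μ T F₀ ξ₀ j)) ∧
        ∀ n : ℕ, 0 < n →
          -- the series `∑ i, c_{n,i} (ξ_i - d_i)` converges in `L_Ψ`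
          (∃ S : Ω → ℝ, OrliczHasSum Ψ μ
            (fun (i : ℤ) ω => c n i * (stationarySeq T ξ₀ i ω - martDiff μ T F₀ ξ₀ i ω)) S) ∧
          -- and its sum satisfies the bound
          ∀ S : Ω → ℝ, OrliczHasSum Ψ μ
            (fun (i : ℤ) ω => c n i * (stationarySeq T ξ₀ i ω - martDiff μ T F₀ ξ₀ i ω)) S →
            ∀ m : ℕ, 0 < m →
              orliczNorm Ψ μ S ≤
                ENNReal.ofReal (2 * C * Real.sqrt (∑' i : ℤ, c n i ^ 2)) *
                    ∑' k : {k : ℤ // (m : ℤ) ≤ |k|},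
                      orliczNorm Ψ μ (proj μ T F₀ 0 (stationarySeq T ξ₀ (k : ℤ))) +
                  ENNReal.ofReal
                      (3 * C * m * Real.sqrt (∑' j : ℤ, (c n j - c n (j - 1)) ^ 2)) *
                    ∑' j : ℤ, orliczNorm Ψ μ (proj μ T F₀ 0 (stationarySeq T ξ₀ j)) := by
  refine ⟨martConst α, martConst_pos, ?_⟩
  intro Ω mΩ μ _ T hT F₀ hF₀ hF Ψ hΨ hconv hsq hne ξ₀ hreg hmem hΘ c hc
  -- `F₀` is also a local instance here, so the ambient σ-algebra has to be named
  have hξ : Integrable[mΩ] ξ₀ μ :=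
    integrable_of_orliczNorm_lt_top hΨ hconv hne hmem.1 ((memOrlicz_iff hΨ hconv).1 hmem).2
  refine ⟨orliczHasSum_martDiff hT hF₀ hΨ hconv hne hξ hΘ, fun n hn => ?_⟩
  obtain ⟨h1, h2⟩ := sum_sub_martDiff_bound hα hT hF₀ hF hΨ hconv hsq hne hξ hreg hΘ (hc n hn)
  refine ⟨h1, fun S hS m _ => (h2 S hS m).trans ?_⟩
  have hC : 0 < martConst α := martConst_pos
  change _ ≤ ENNReal.ofReal (2 * martConst α * l2Norm (c n)) * _ + ENNReal.ofReal
    (3 * martConst α * m * l2Norm fun i => c n i - c n (i - 1)) * _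
  have hD : 0 ≤ l2Norm fun i => c n i - c n (i - 1) := l2Norm_nonneg
  gcongr
  linarith
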